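/- **Theorem (Timed common prefix).** *Blocks, chains, trees.* Slots are natural numbers. A block consists of the hash of its predecessor, a slot, a payload and a baker identifier (a party). Fixed parameters are a hash function on blocks, a lottery $\mathrm{Winner}(p,s)\in\{\top,\bot\}$, a predicate $\mathrm{Honest}(p)$ on parties (parties that are not honest are corrupted), a genesis block with slot $0$ and an honest baker, and a duplicate-free list $\mathrm{InitParties}$ of participants. A chain (a list of blocks, newest first) is valid if the baker of each of its blocks won the block's slot, each block contains the hash of the next block in the list, the list ends in the genesis block, and slots are strictly decreasing. Each party uses its own block tree implementation, of which only the following is assumed: the initial tree contains just the genesis block; extending a tree by a block adds exactly this block; and $\mathrm{bestChain}(s,t)$ is a valid chain, of maximal length, among the chains made of blocks of the tree $t$ with slot $\le s$. We assume that every corrupted party that wins some slot belongs to $\mathrm{InitParties}$. *Execution.* A global state consists of a clock (current slot), a buffer of messages in transit, the local states (trees) of the participants, the history of sent blocks, the state of the adversary, an execution order of the participants, and a progress in $\{\text{Ready},\text{Delivered},\text{Baked}\}$. The initial state $N_0$ has clock $1$, progress Ready, an empty buffer, an empty history and initial trees. The atomic steps are: *Receive* (Ready to Delivered), where all participants are activated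 in the execution order, an honest one adding to its tree all blocks that are due for it, and a corrupted one discarding its due messages and then calling the adversary; *Bake* (Delivered to Baked), where all participants are activated in the execution order, a corrupted one calling the adversary, and an honest winner $p$ of the current slot $s$ with tree $t$ creating a block of slot $s$ with baker $p$ on top of $\mathrm{bestChain}(s-1,t)$, with the payload that a fixed function assigns to $s$ and $p$, adding it to its tree and sending it to all participants; *Increment* (Baked to Ready), where the clock advances by one; and arbitrary permutations of the execution order or of the message buffer. When called, the adversary (two arbitrary functions, one for receiving and one for baking) sees the clock, the history, the buffer and its own state, updates its state and sends any blocks to all participants. A block sent in slot $s$ by an honest party is due in slot $s+1$; for a block sent by the adversary, the adversary chooses $s+1$ or $s+2$ separately for each receiver. The local states of corrupted parties never change. Write $N\Downarrow N'$ if $N'$ is reached from $N$ by zero or more atomic steps. The block history of a state consists of the genesis block and all blocks sent so far. A state $N$ is *collision-free* if the hash function is injective on its block history, and *forging-free* if in every execution from $N_0$ to $N$, whenever the adversary is called, each block with an honest baker identifier that it sends is already in the block history at that moment. *Slots.* A slot is a *super slot* if it is won by exactly one honest party of $\mathrm{InitParties}$, and an *adversarial slot* if it is won by at least one corrupted party of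 $\mathrm{InitParties}$. Let $\mathrm{prune}_k(c)$ be the chain $c$ without its blocks of slot $>k$. A chain $c_1$ is a *prefix* of $c_2$ if $c_2=c_3\mathbin{+\!\!+}c_1$ for some list $c_3$ (chains are written newest block first). *Statement.* Let $N_0\Downarrow N_1\Downarrow N_2$ with $N_2$ forging-free and collision-free, let $p_1$ be a party in $N_1$ with tree $t_1$, let $p_2$ be an honest party in $N_2$ with tree $t_2$, let $sl_1$ and $sl_2$ be the clocks of $N_1$ and $N_2$, and let $k$ be any slot. Then at least one of the following holds. 1. $\mathrm{prune}_k(\mathrm{bestChain}(sl_1-1,t_1))$ is a prefix of $\mathrm{bestChain}(sl_2-1,t_2)$. 2. There exist slots $sl',sl''$ with $sl'\le k$ and $sl_1\le sl''\le sl_2$ such that the number of super slots $s$ with $sl'\le s\le sl''-2$ is at most twice the number of adversarial slots $s$ with $sl'\le s\le sl''-1$. -/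

import Mathlib

universe u₁ u₂ u₃ v w

namespace NSB

/-- Blocks: hash of the predecessor, slot, payload and baker identifier. Slots are natural
numbers. -/
structure Block (Party : Type u₁) (Hash : Type u₂) (Tx : Type u₃) where
  pred : Hash
  slot : ℕ
  txs : Tx
  bid : Party

/-- A chain is a list of blocks, the newest block first. -/
abbrev Chain (Party : Type u₁) (Hash : Type u₂) (Tx : Type u₃) := List (Block Party Hash Tx)

/-- The parameters on which the validity of chains depends. -/
structure ChainParams (Party : Type u₁) (Hash : Type u₂) (Tx : Type u₃) where
  genesis : Block Party Hash Tx
  hashBlock : Block Party Hash Tx → Hash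
  winner : Party → ℕ → Bool

/-- Every block is valid (its baker won its slot), every block points to the hash of the next
one in the list, the list ends in the genesis block, and slots are strictly decreasing. -/
structure ValidChain {Party : Type u₁} {Hash : Type u₂} {Tx : Type u₃}
    (C : ChainParams Party Hash Tx) (c : Chain Party Hash Tx) : Prop where
  valid : ∀ b ∈ c, C.winner b.bid b.slot = true
  linked : c.IsChain (fun b b' => b.pred = C.hashBlock b')
  ends : c.getLast? = some C.genesis
  decreasing : (c.map Block.slot).Pairwise (· > ·)

/-- A block tree implementation: instantiated, extendable, valid, optimal and self-contained. -/
structure TreeType {Party : Type u₁} {Hash : Type u₂} {Tx : Type u₃}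
    (C : ChainParams Party Hash Tx) where
  T : Type v
  tree0 : T
  extendTree : T → Block Party Hash Tx → T
  allBlocks : T → List (Block Party Hash Tx)
  bestChain : ℕ → T → Chain Party Hash Tx
  instantiated : ∀ b, b ∈ allBlocks tree0 ↔ b ∈ [C.genesis]
  extendable : ∀ t b b', b' ∈ allBlocks (extendTree t b) ↔ b' ∈ allBlocks t ++ [b]
  valid : ∀ t sl, ValidChain C (bestChain sl t)
  optimal : ∀ (c : Chain Party Hash Tx) t sl, ValidChain C c →
    (∀ b ∈ c, b ∈ allBlocks t ∧ b.slot ≤ sl) → c.length ≤ (bestChain sl t).length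
  selfContained : ∀ t sl, ∀ b ∈ bestChain sl t, b ∈ allBlocks t ∧ b.slot ≤ sl

inductive Message (Party : Type u₁) (Hash : Type u₂) (Tx : Type u₃) where
  | blockMsg : Block Party Hash Tx → Message Party Hash Tx

def Message.block {Party : Type u₁} {Hash : Type u₂} {Tx : Type u₃} :
    Message Party Hash Tx → Block Party Hash Tx
  | .blockMsg b => b

/-- The delays with which a message can be sent. -/
inductive Delay where
  | one
  | two

def Delay.toNat : Delay → ℕ
  | .one => 1
  | .two => 2

abbrev DelayMap (Party : Type u₁) := Party → Delay

/-- A message in transit to `rcv`. The counter `cd` is the delay (1 or 2) at sending time; it is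
decremented whenever the clock advances, and the message is delivered once `cd` is 0. -/
structure MsgTuple (Party : Type u₁) (Hash : Type u₂) (Tx : Type u₃) where
  msg : Message Party Hash Tx
  rcv : Party
  cd : ℕ

/-- The parameters of the development. The adversary's functions are given the current slot, the
history of all messages sent, the messages in transit, and the adversary's state. -/
structure Protocol (Party : Type u₁) (Hash : Type u₂) (Tx : Type u₃) extends
    ChainParams Party Hash Tx where
  initParties : List Party
  treeTypeMap : Party → TreeType.{u₁, u₂, u₃, v} toChainParams
  txSelection : ℕ → Party → Tx
  honest : Party → Bool
  AdvState : Type w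
  advState0 : AdvState
  adversarialRcv : ℕ → List (Message Party Hash Tx) → List (MsgTuple Party Hash Tx) → AdvState →
    List (Message Party Hash Tx × DelayMap Party) × AdvState
  adversarialBake : ℕ → List (Message Party Hash Tx) → List (MsgTuple Party Hash Tx) → AdvState →
    List (Message Party Hash Tx × DelayMap Party) × AdvState

/-- The local state of a party: identity, tree implementation, and tree. -/
structure LocalState {Party : Type u₁} {Hash : Type u₂} {Tx : Type u₃}
    (C : ChainParams Party Hash Tx) where
  id : Party
  tT : TreeType.{u₁, u₂, u₃, v} C
  tree : tT.T

/-- The best chain of a local state, disregarding blocks from slots later than `sl`. -/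
def LocalState.bestChain {Party : Type u₁} {Hash : Type u₂} {Tx : Type u₃}
    {C : ChainParams Party Hash Tx} (l : LocalState.{u₁, u₂, u₃, v} C) (sl : ℕ) :
    Chain Party Hash Tx :=
  l.tT.bestChain sl l.tree

def LocalState.extend {Party : Type u₁} {Hash : Type u₂} {Tx : Type u₃}
    {C : ChainParams Party Hash Tx} (l : LocalState.{u₁, u₂, u₃, v} C)
    (b : Block Party Hash Tx) : LocalState.{u₁, u₂, u₃, v} C :=
  ⟨l.id, l.tT, l.tT.extendTree l.tree b⟩

/-- Honest receiving: extend the tree with every received block. -/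
def honestRcv {Party : Type u₁} {Hash : Type u₂} {Tx : Type u₃}
    {C : ChainParams Party Hash Tx} (msgs : List (Message Party Hash Tx))
    (l : LocalState.{u₁, u₂, u₃, v} C) : LocalState.{u₁, u₂, u₃, v} C :=
  msgs.foldl (fun l m => l.extend m.block) l

/-- Honest baking in slot `sl`: a winner extends its best chain, which at slot `sl` is calculated
from the blocks of slots before `sl`, with a new block, adds this block to its tree, and returns
it as a message to be flooded. -/
def honestBake {Party : Type u₁} {Hash : Type u₂} {Tx : Type u₃}
    {C : ChainParams Party Hash Tx} (sl : ℕ) (txs : Tx) (l : LocalState.{u₁, u₂, u₃, v} C) :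
    List (Message Party Hash Tx) × LocalState.{u₁, u₂, u₃, v} C :=
  if C.winner l.id sl = true then
    let b : Block Party Hash Tx :=
      ⟨C.hashBlock ((l.bestChain (sl - 1)).headD C.genesis), sl, txs, l.id⟩
    ([.blockMsg b], l.extend b)
  else ([], l)

inductive Progress where
  | ready
  | delivered
  | baked

structure GlobalState {Party : Type u₁} {Hash : Type u₂} {Tx : Type u₃}
    (P : Protocol.{u₁, u₂, u₃, v, w} Party Hash Tx) where
  clock : ℕ
  msgBuff : List (MsgTuple Party Hash Tx)
  stateMap : Party → Option (LocalState.{u₁, u₂, u₃, v} P.toChainParams)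
  history : List (Message Party Hash Tx)
  advState : P.AdvState
  execOrder : List Party
  progress : Progress

section Semantics

variable {Party : Type u₁} {Hash : Type u₂} {Tx : Type u₃} [DecidableEq Party]
  (P : Protocol.{u₁, u₂, u₃, v, w} Party Hash Tx)

/-- The initial global state. The genesis block occupies slot 0, so the first slot is 1. -/
def initState : GlobalState P where
  clock := 1
  msgBuff := []
  stateMap := fun p =>
    if p ∈ P.initParties then some ⟨p, P.treeTypeMap p, (P.treeTypeMap p).tree0⟩ else none
  history := []
  advState := P.advState0
  execOrder := P.initParties
  progress := .ready

variable {P}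

/-- Honest flooding: every party gets the messages with delay 1. -/
def floodMsgs (ms : List (Message Party Hash Tx)) (N : GlobalState P) : GlobalState P :=
  { N with
    msgBuff := N.msgBuff ++ ms.flatMap (fun m => N.execOrder.map (fun p => ⟨m, p, 1⟩))
    history := N.history ++ ms }

/-- Adversarial flooding: every party gets the messages, with a delay of 1 or 2 chosen by the
adversary for each message and each receiver. -/
def floodMsgsAdv (ms : List (Message Party Hash Tx × DelayMap Party)) (N : GlobalState P) :
    GlobalState P :=
  { N with
    msgBuff := N.msgBuff ++
      ms.flatMap (fun m => N.execOrder.map (fun p => ⟨m.1, p, (m.2 p).toNat⟩))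
    history := N.history ++ ms.map Prod.fst }

/-- The messages that are due for `p`. -/
def dueMsgs (p : Party) (N : GlobalState P) : List (Message Party Hash Tx) :=
  (N.msgBuff.filter (fun m => decide (m.rcv = p ∧ m.cd = 0))).map MsgTuple.msg

/-- Remove the messages that are due for `p` from the buffer. -/
def removeDue (p : Party) (N : GlobalState P) : GlobalState P :=
  { N with msgBuff := N.msgBuff.filter (fun m => decide (¬ (m.rcv = p ∧ m.cd = 0))) }

def setLocal (p : Party) (l : LocalState.{u₁, u₂, u₃, v} P.toChainParams) (N : GlobalState P) :
    GlobalState P :=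
  { N with stateMap := Function.update N.stateMap p (some l) }

/-- What the adversary sends, and its new state, when `AdversarialRcv` is called on `N`. -/
def advRcvOut (N : GlobalState P) : List (Message Party Hash Tx × DelayMap Party) × P.AdvState :=
  P.adversarialRcv N.clock N.history N.msgBuff N.advState

/-- What the adversary sends, and its new state, when `AdversarialBake` is called on `N`. -/
def advBakeOut (N : GlobalState P) : List (Message Party Hash Tx × DelayMap Party) × P.AdvState :=
  P.adversarialBake N.clock N.history N.msgBuff N.advState

/-- Activation of a single party for delivery. -/
def rcvParty (N : GlobalState P) (p : Party) : GlobalState P :=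
  if P.honest p = true then
    match N.stateMap p with
    | some l => setLocal p (honestRcv (dueMsgs p N) l) (removeDue p N)
    | none => removeDue p N
  else
    floodMsgsAdv (advRcvOut (removeDue p N)).1
      { removeDue p N with advState := (advRcvOut (removeDue p N)).2 }

/-- Activation of a single party for baking. -/
def bakeParty (N : GlobalState P) (p : Party) : GlobalState P :=
  if P.honest p = true then
    match N.stateMap p with
    | some l =>
      floodMsgs (honestBake N.clock (P.txSelection N.clock p) l).1
        (setLocal p (honestBake N.clock (P.txSelection N.clock p) l).2 N)
    | none => N
  else
    floodMsgsAdv (advBakeOut N).1 { N with advState := (advBakeOut N).2 }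

/-- Activate all parties for delivery, in the execution order. -/
def receiveAll (N : GlobalState P) : GlobalState P :=
  { N.execOrder.foldl rcvParty N with progress := .delivered }

/-- Activate all parties for baking, in the execution order. -/
def bakeAll (N : GlobalState P) : GlobalState P :=
  { N.execOrder.foldl bakeParty N with progress := .baked }

/-- Advance the clock and decrement the delays of all messages in transit. -/
def incrementSlot (N : GlobalState P) : GlobalState P :=
  { N with
    clock := N.clock + 1
    msgBuff := N.msgBuff.map (fun m => { m with cd := m.cd - 1 })
    progress := .ready }

/-- Atomic steps. -/
inductive Step : GlobalState P → GlobalState P → Prop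
  | receive (N : GlobalState P) : N.progress = .ready → Step N (receiveAll N)
  | bake (N : GlobalState P) : N.progress = .delivered → Step N (bakeAll N)
  | increment (N : GlobalState P) : N.progress = .baked → Step N (incrementSlot N)
  | permuteExecOrder (N : GlobalState P) (o : List Party) :
      o.Perm N.execOrder → Step N { N with execOrder := o }
  | permuteMsgBuff (N : GlobalState P) (ms : List (MsgTuple Party Hash Tx)) :
      ms.Perm N.msgBuff → Step N { N with msgBuff := ms }

/-- Reachability in zero or more atomic steps. -/
def Reachable (N₁ N₂ : GlobalState P) : Prop :=
  Relation.ReflTransGen Step N₁ N₂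

/-- The block history: the genesis block and all blocks that have been sent. -/
def blockHistory (N : GlobalState P) : List (Block Party Hash Tx) :=
  P.genesis :: N.history.map Message.block

def CollisionFree (N : GlobalState P) : Prop :=
  ∀ b ∈ blockHistory N, ∀ b' ∈ blockHistory N, P.hashBlock b = P.hashBlock b' → b = b'

/-- Every honest block among the messages `ms` is already in the block history of `N`. -/
def NoForgery (ms : List (Message Party Hash Tx × DelayMap Party)) (N : GlobalState P) : Prop :=
  ∀ m ∈ ms, P.honest m.1.block.bid = true → m.1.block ∈ blockHistory N

/-- In the executions from the initial state to `N`, no activation of the adversary forges an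
honest block. The activations are considered one by one: if the parties of the list `pre` come
before the corrupted party `p` in the execution order of a state `M`, then `p` is activated on
the state that results from `M` by activating the parties of `pre`. -/
def ForgingFree (N : GlobalState P) : Prop :=
  ∀ (M : GlobalState P) (pre : List Party) (p : Party) (post : List Party),
    Reachable (initState P) M → M.execOrder = pre ++ p :: post → P.honest p = false →
      (M.progress = .ready → Reachable (receiveAll M) N →
        NoForgery (advRcvOut (removeDue p (pre.foldl rcvParty M))).1 (pre.foldl rcvParty M)) ∧
      (M.progress = .delivered → Reachable (bakeAll M) N →
        NoForgery (advBakeOut (pre.foldl bakeParty M)).1 (pre.foldl bakeParty M))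

end Semantics

section Slots

variable {Party : Type u₁} {Hash : Type u₂} {Tx : Type u₃}
  (P : Protocol.{u₁, u₂, u₃, v, w} Party Hash Tx)

/-- Exactly one participating honest party wins the slot. -/
def SuperSlot (sl : ℕ) : Prop :=
  ∃! p, p ∈ P.initParties ∧ P.winner p sl = true ∧ P.honest p = true

/-- Some participating corrupted party wins the slot. -/
def AdvSlot (sl : ℕ) : Prop :=
  ∃ p ∈ P.initParties, P.winner p sl = true ∧ P.honest p = false

open Classical in
/-- The number of super slots `s` with `a ≤ s < b`. -/
noncomputable def numSuperSlots (a b : ℕ) : ℕ :=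
  ((Finset.Ico a b).filter (SuperSlot P)).card

open Classical in
/-- The number of adversarial slots `s` with `a ≤ s < b`. -/
noncomputable def numAdvSlots (a b : ℕ) : ℕ :=
  ((Finset.Ico a b).filter (AdvSlot P)).card

end Slots

/-- Remove all blocks with a slot higher than `sl`. -/
def prune {Party : Type u₁} {Hash : Type u₂} {Tx : Type u₃} (sl : ℕ)
    (c : Chain Party Hash Tx) : Chain Party Hash Tx :=
  c.filter (fun b => decide (b.slot ≤ sl))

/-- `c₁` is a prefix of `c₂`: as the newest block comes first, `c₃ ++ c₁ = c₂` for some `c₃`. -/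
def ChainPrefix {Party : Type u₁} {Hash : Type u₂} {Tx : Type u₃}
    (c₁ c₂ : Chain Party Hash Tx) : Prop :=
  ∃ c₃ : Chain Party Hash Tx, c₃ ++ c₁ = c₂

end NSB

/-!
Call a block honest if its baker is honest, and let the height of a block be the length of the
chain below it, which the block determines as there are no hash collisions
(`ValidChain.eq_of_head_eq`).

All that one honest party knows reaches the others in the next slot: an honest block takes one slot,
and the delays that the adversary chooses for two receivers differ by at most one. So the chain
of an honest block of slot `s` is known to all honest parties when they bake in slot `s + 1`, and
since they extend a longest chain, heights of honest blocks strictly increase with their slots. As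
the adversary does not forge honest blocks, each super slot has just one honest block, and it is
the only honest block of its height. These facts are collected in the invariant `Inv`, which every
activation of a party preserves (`progressInv_of_reachable`).

Let `c₁` and `c₂` be the two best chains, and `A` their highest common honest block. If `A` is from
slot `k` or later, then the pruned chain ends inside the common part. Otherwise take `sl'` to be the
slot after that of `A`. Suppose first that `c₂` has no honest block from slot `sl₁ - 1` or later,
and take `sl'' = sl₂`. Let `S` be the block of a super slot between `sl'` and `sl'' - 2`. It is at
most as high as `c₂`. If `c₂` has an honest block at the height of `S`, this is `S` itself; then
`S` is from a slot up to `sl₁ - 2` and at most as high as `c₁`, and the block of `c₁` at its height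
is not honest, since otherwise `S` would be a common honest block above `A`. Thus `S` can be charged
to a corrupted block in `c₁` or `c₂` of the same height, which is above `A`. Different super slots
have different heights, and slots in a chain are distinct, so that each adversarial slot is charged
at most once for each of the two chains (`Inv.prune_suffix_or_numSuperSlots_le`).

If `c₂` does have an honest block from slot `sl₁ - 1` or later, let `B` be the lowest one. The chain
below `B` was the best chain of its baker, so it can take the place of `c₂`, with `sl''` the maximum
of `sl₁` and the slot of `B`.
-/

namespace NSB

/-! ### Trees of local states -/

section LocalStates

variable {Party : Type u₁} {Hash : Type u₂} {Tx : Type u₃} {C : ChainParams Party Hash Tx}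

/-- The blocks in the tree of a local state. -/
def LocalState.blocks (l : LocalState.{u₁, u₂, u₃, v} C) : List (Block Party Hash Tx) :=
  l.tT.allBlocks l.tree

theorem LocalState.mem_blocks_extend (l : LocalState.{u₁, u₂, u₃, v} C)
    (b b' : Block Party Hash Tx) : b' ∈ (l.extend b).blocks ↔ b' ∈ l.blocks ∨ b' = b := by
  have := l.tT.extendable l.tree b b'
  simpa [LocalState.blocks, LocalState.extend] using this

theorem honestRcv_id (msgs : List (Message Party Hash Tx)) (l : LocalState.{u₁, u₂, u₃, v} C) :
    (honestRcv msgs l).id = l.id := by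
  induction msgs generalizing l with
  | nil => rfl
  | cons m ms ih => exact ih (l.extend m.block)

theorem mem_blocks_honestRcv (msgs : List (Message Party Hash Tx))
    (l : LocalState.{u₁, u₂, u₃, v} C) (b : Block Party Hash Tx) :
    b ∈ (honestRcv msgs l).blocks ↔ b ∈ l.blocks ∨ ∃ m ∈ msgs, m.block = b := by
  induction msgs generalizing l with
  | nil => simp [honestRcv]
  | cons m ms ih =>
    have := ih (l.extend m.block)
    rw [LocalState.mem_blocks_extend] at this
    simp only [honestRcv, List.foldl_cons] at this ⊢
    rw [this]
    simp only [List.mem_cons, exists_eq_or_imp, or_assoc, eq_comm (a := b)]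

theorem LocalState.bestChain_valid (l : LocalState.{u₁, u₂, u₃, v} C) (sl : ℕ) :
    ValidChain C (l.bestChain sl) :=
  l.tT.valid _ _

theorem LocalState.mem_blocks_of_mem_bestChain (l : LocalState.{u₁, u₂, u₃, v} C) {sl : ℕ}
    {b : Block Party Hash Tx} (h : b ∈ l.bestChain sl) : b ∈ l.blocks :=
  (l.tT.selfContained _ _ b h).1

theorem LocalState.slot_le_of_mem_bestChain (l : LocalState.{u₁, u₂, u₃, v} C) {sl : ℕ}
    {b : Block Party Hash Tx} (h : b ∈ l.bestChain sl) : b.slot ≤ sl :=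
  (l.tT.selfContained _ _ b h).2

theorem LocalState.length_le_bestChain (l : LocalState.{u₁, u₂, u₃, v} C) {sl : ℕ}
    {c : Chain Party Hash Tx} (hc : ValidChain C c) (hb : ∀ b ∈ c, b ∈ l.blocks)
    (hs : ∀ b ∈ c, b.slot ≤ sl) : c.length ≤ (l.bestChain sl).length :=
  l.tT.optimal c _ _ hc fun b h => ⟨hb b h, hs b h⟩

end LocalStates

/-! ### Valid chains -/

section ValidChains

variable {Party : Type u₁} {Hash : Type u₂} {Tx : Type u₃} {C : ChainParams Party Hash Tx}

theorem ValidChain.ne_nil {c : Chain Party Hash Tx} (h : ValidChain C c) : c ≠ [] := by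
  rintro rfl
  simpa using h.ends

theorem ValidChain.slot_lt {b x : Block Party Hash Tx} {c : Chain Party Hash Tx}
    (h : ValidChain C (b :: c)) (hx : x ∈ c) : x.slot < b.slot := by
  have := h.decreasing
  rw [List.map_cons, List.pairwise_cons] at this
  exact this.1 _ (List.mem_map_of_mem hx)

theorem ValidChain.slot_le {b x : Block Party Hash Tx} {c : Chain Party Hash Tx}
    (h : ValidChain C (b :: c)) (hx : x ∈ b :: c) : x.slot ≤ b.slot := by
  rcases List.mem_cons.1 hx with rfl | hx
  · exact le_rfl
  · exact (h.slot_lt hx).le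

theorem ValidChain.suffix {b : Block Party Hash Tx} {r c : Chain Party Hash Tx}
    (h : ValidChain C c) (hr : b :: r <:+ c) : ValidChain C (b :: r) where
  valid x hx := h.valid x (hr.subset hx)
  linked := h.linked.suffix hr
  ends := by
    obtain ⟨t, rfl⟩ := hr
    have := h.ends
    rwa [List.getLast?_append_of_ne_nil _ (by simp)] at this
  decreasing := by
    obtain ⟨t, rfl⟩ := hr
    have := h.decreasing
    rw [List.map_append, List.pairwise_append] at this
    exact this.2.1

theorem ValidChain.genesis_mem {c : Chain Party Hash Tx} (h : ValidChain C c) : C.genesis ∈ c :=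
  List.mem_of_getLast? h.ends

/-- Putting a block of a later slot on top of a valid chain. -/
theorem ValidChain.cons {b : Block Party Hash Tx} {c : Chain Party Hash Tx}
    (h : ValidChain C c) (hw : C.winner b.bid b.slot = true)
    (hp : b.pred = C.hashBlock (c.headD C.genesis)) (hs : ∀ x ∈ c, x.slot < b.slot) :
    ValidChain C (b :: c) where
  valid x hx := by
    rcases List.mem_cons.1 hx with rfl | hx
    · exact hw
    · exact h.valid x hx
  linked := by
    rw [List.isChain_cons]
    refine ⟨fun y hy => ?_, h.linked⟩
    rw [hp, List.headD_eq_head?_getD, Option.mem_def.1 hy]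
    rfl
  ends := by
    rw [List.getLast?_cons_of_ne_nil h.ne_nil]
    exact h.ends
  decreasing := by
    rw [List.map_cons, List.pairwise_cons]
    refine ⟨fun s hs' => ?_, h.decreasing⟩
    obtain ⟨x, hx, rfl⟩ := List.mem_map.1 hs'
    exact hs x hx

/-- In a set of blocks without hash collisions, a block determines the chain below it. -/
theorem ValidChain.eq_of_head_eq {H : List (Block Party Hash Tx)}
    (hH : ∀ b ∈ H, ∀ b' ∈ H, C.hashBlock b = C.hashBlock b' → b = b')
    (h0 : C.genesis.slot = 0) {b : Block Party Hash Tx} {r r' : Chain Party Hash Tx}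
    (h : ValidChain C (b :: r)) (h' : ValidChain C (b :: r'))
    (hr : ∀ x ∈ r, x ∈ H) (hr' : ∀ x ∈ r', x ∈ H) : r = r' := by
  have slot_pos : ∀ {b : Block Party Hash Tx} {r : Chain Party Hash Tx} {x},
      ValidChain C (b :: x :: r) → ¬ ValidChain C (b :: []) := by
    intro b r x h1 h2
    have e : b = C.genesis := by simpa using h2.ends
    have := h1.slot_lt (x := x) (by simp)
    rw [e, h0] at this
    omega
  induction r generalizing b r' with
  | nil =>
    cases r' with
    | nil => rfl
    | cons x r' => exact absurd h (slot_pos h')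
  | cons x r ih =>
    cases r' with
    | nil => exact absurd h' (slot_pos h)
    | cons y r' =>
      have e1 := (List.isChain_cons_cons.1 h.linked).1
      have e2 := (List.isChain_cons_cons.1 h'.linked).1
      have : x = y := hH _ (hr x (by simp)) _ (hr' y (by simp)) (e1.symm.trans e2)
      subst this
      rw [ih (h.suffix (List.suffix_cons _ _)) (h'.suffix (List.suffix_cons _ _))
        (fun z hz => hr z (by simp [hz])) (fun z hz => hr' z (by simp [hz]))]

/-- The slots of a valid chain are distinct. -/
theorem ValidChain.suffix_unique {c : Chain Party Hash Tx} (h : ValidChain C c)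
    {x y : Block Party Hash Tx} {r r' : Chain Party Hash Tx} (hx : x :: r <:+ c)
    (hy : y :: r' <:+ c) (he : x.slot = y.slot) : x :: r = y :: r' := by
  wlog hl : (x :: r).length ≤ (y :: r').length generalizing x y r r'
  · exact (this hy hx he.symm (by omega)).symm
  rcases List.suffix_cons_iff.1 (List.suffix_of_suffix_length_le hx hy hl) with e | e
  · exact e
  · have := (h.suffix hy).slot_lt (e.subset (List.mem_cons_self (a := x)))
    omega

theorem ValidChain.lt_slot_of_length_lt {c : Chain Party Hash Tx} (h : ValidChain C c)
    {x y : Block Party Hash Tx} {r r' : Chain Party Hash Tx} (hx : x :: r <:+ c)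
    (hy : y :: r' <:+ c) (hl : r.length < r'.length) : x.slot < y.slot := by
  rcases List.suffix_cons_iff.1 (List.suffix_of_suffix_length_le hx hy (by simp; omega)) with e | e
  · rw [(List.cons.inj e).2] at hl
    omega
  · exact (h.suffix hy).slot_lt (e.subset (List.mem_cons_self (a := x)))

/-- Pruning a valid chain leaves a suffix, contained in any suffix that starts in a slot `≥ k`. -/
theorem ValidChain.prune_suffix {c : Chain Party Hash Tx} (h : ValidChain C c)
    {x : Block Party Hash Tx} {r : Chain Party Hash Tx} (hx : x :: r <:+ c) {k : ℕ}
    (hk : k ≤ x.slot) : prune k c <:+ x :: r := by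
  have key : ∀ d : Chain Party Hash Tx, (d.map Block.slot).Pairwise (· > ·) →
      prune k d <:+ d := by
    intro d
    induction d with
    | nil => intro _; exact List.suffix_rfl
    | cons y d ih =>
      intro hd
      rw [List.map_cons, List.pairwise_cons] at hd
      by_cases hy : y.slot ≤ k
      · have : prune k (y :: d) = y :: d := by
          refine List.filter_eq_self.2 fun z hz => ?_
          rcases List.mem_cons.1 hz with rfl | hz
          · simpa using hy
          · have := hd.1 _ (List.mem_map_of_mem hz)
            simp only [decide_eq_true_eq]
            omega
        rw [this]
      · have : prune k (y :: d) = prune k d := by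
          simp [prune, hy]
        rw [this]
        exact (ih hd.2).trans (List.suffix_cons _ _)
  have hdec := h.decreasing
  obtain ⟨t, rfl⟩ := hx
  rw [List.map_append, List.pairwise_append] at hdec
  have : prune k (t ++ x :: r) = prune k (x :: r) := by
    unfold prune
    rw [List.filter_append, List.filter_eq_nil_iff.2, List.nil_append]
    intro y hy
    have := hdec.2.2 _ (List.mem_map_of_mem hy) x.slot (by simp)
    simp only [decide_eq_true_eq]
    omega
  rw [this]
  exact key _ hdec.2.1

theorem exists_suffix_length {α : Type*} {c : List α} {n : ℕ} (h : n < c.length) :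
    ∃ x r, x :: r <:+ c ∧ r.length = n := by
  induction c with
  | nil => simp at h
  | cons y c ih =>
    rcases Nat.lt_succ_iff_lt_or_eq.1 h with h | h
    · obtain ⟨x, r, hr, e⟩ := ih h
      exact ⟨x, r, hr.trans (List.suffix_cons _ _), e⟩
    · exact ⟨y, c, List.suffix_rfl, h.symm⟩

theorem exists_suffix_of_mem {α : Type*} {c : List α} {x : α} (h : x ∈ c) :
    ∃ r, x :: r <:+ c := by
  obtain ⟨s, t, rfl⟩ := List.append_of_mem h
  exact ⟨t, s, rfl⟩

end ValidChains

/-! ### The invariant of executions -/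

section Invariant

variable {Party : Type u₁} {Hash : Type u₂} {Tx : Type u₃}
  {P : Protocol.{u₁, u₂, u₃, v, w} Party Hash Tx}

/-- The block `b` is in the tree of the local state `l` of `q`, or it is in transit to `q` and due
after at most `j` increments of the clock. -/
def Avail (N : GlobalState P) (q : Party) (l : LocalState.{u₁, u₂, u₃, v} P.toChainParams)
    (b : Block Party Hash Tx) (j : ℕ) : Prop :=
  b ∈ l.blocks ∨ ∃ m ∈ N.msgBuff, m.msg.block = b ∧ m.rcv = q ∧ m.cd ≤ j

/-- The chain `c` makes `b :: c` a valid chain of blocks of `H`, and every honest block of `H` from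
an earlier slot than `b` has such a chain that is shorter than `c`. -/
structure GrowingChain (P : Protocol.{u₁, u₂, u₃, v, w} Party Hash Tx)
    (H : List (Block Party Hash Tx)) (b : Block Party Hash Tx) (c : Chain Party Hash Tx) :
    Prop where
  valid : ValidChain P.toChainParams (b :: c)
  sub : ∀ x ∈ c, x ∈ H
  growth : ∀ b' ∈ H, P.honest b'.bid = true → b'.slot < b.slot →
    ∃ c', ValidChain P.toChainParams (b' :: c') ∧ (∀ x ∈ c', x ∈ H) ∧ c'.length < c.length

theorem GrowingChain.mono {H H' : List (Block Party Hash Tx)} {b : Block Party Hash Tx}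
    {c : Chain Party Hash Tx} (h : GrowingChain P H b c) (hH : ∀ x ∈ H, x ∈ H')
    (hH' : ∀ x ∈ H', P.honest x.bid = true → x.slot < b.slot → x ∈ H) :
    GrowingChain P H' b c where
  valid := h.valid
  sub x hx := hH x (h.sub x hx)
  growth b' hb' hh hs := by
    obtain ⟨c', h1, h2, h3⟩ := h.growth b' (hH' b' hb' hh hs) hh hs
    exact ⟨c', h1, fun x hx => hH x (h2 x hx), h3⟩

/-- The invariant of executions without forgery. The sets `r` and `d` contain the parties that
have been activated for delivery and for baking in the current slot; as they are arguments, the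
invariant also covers the states between the activations of two parties. -/
structure Inv (N : GlobalState P) (r d : Set Party) : Prop where
  order : N.execOrder.Perm P.initParties
  clock_pos : 1 ≤ N.clock
  some_of_mem : ∀ p ∈ P.initParties, ∃ l, N.stateMap p = some l
  of_some : ∀ p l, N.stateMap p = some l → p ∈ P.initParties ∧ l.id = p
  corrupt : ∀ p l, N.stateMap p = some l → P.honest p = false → ∀ b ∈ l.blocks, b = P.genesis
  tree_sub : ∀ p l, N.stateMap p = some l → ∀ b ∈ l.blocks, b ∈ blockHistory N
  msg_sub : ∀ m ∈ N.msgBuff, m.msg.block ∈ blockHistory N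
  /-- What one honest party knows, every other one knows after the next delivery phase. -/
  tree_avail : ∀ p l, N.stateMap p = some l → P.honest p = true →
    ∀ q l', N.stateMap q = some l' → P.honest q = true → ∀ b ∈ l.blocks, Avail N q l' b 1
  /-- Delays of the same message differ by at most 1. -/
  msg_avail : ∀ m ∈ N.msgBuff, ∀ q l', N.stateMap q = some l' → P.honest q = true →
    Avail N q l' m.msg.block (m.cd + 1)
  /-- Every honest block has a chain which is longer than those of all earlier honest blocks, and
  which reaches all honest parties in the slot after that of the block. -/
  honest_chain : ∀ b ∈ blockHistory N, P.honest b.bid = true →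
    ∃ c, GrowingChain P (blockHistory N) b c ∧
      ∀ q l', N.stateMap q = some l' → P.honest q = true → ∀ x ∈ b :: c,
        Avail N q l' x (b.slot + 1 - N.clock) ∧ (b.slot + 1 < N.clock → x ∈ l'.blocks)
  due : ∀ m ∈ N.msgBuff, m.rcv ∈ r → m.cd ≠ 0
  honest_slot : ∀ b ∈ blockHistory N, P.honest b.bid = true → b = P.genesis ∨
    1 ≤ b.slot ∧ b.slot ≤ N.clock ∧ b.bid ∈ P.initParties
  unique : ∀ b ∈ blockHistory N, ∀ b' ∈ blockHistory N, P.honest b.bid = true → 1 ≤ b.slot →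
    b.slot = b'.slot → b.bid = b'.bid → b = b'
  baked : ∀ p ∈ P.initParties, P.honest p = true → ∀ s, P.winner p s = true → 1 ≤ s →
    s < N.clock ∨ s = N.clock ∧ p ∈ d → ∃ b ∈ blockHistory N, b.bid = p ∧ b.slot = s
  not_baked : ∀ b ∈ blockHistory N, P.honest b.bid = true → 1 ≤ b.slot →
    b.slot < N.clock ∨ b.bid ∈ d

theorem Avail.mono {N N' : GlobalState P} {q : Party}
    {l l' : LocalState.{u₁, u₂, u₃, v} P.toChainParams} {b : Block Party Hash Tx} {j j' : ℕ}
    (h : Avail N q l b j)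
    (hm : ∀ m ∈ N.msgBuff, m.rcv = q → m ∈ N'.msgBuff ∨ m.cd = 0 ∧ m.msg.block ∈ l'.blocks)
    (hl : ∀ x ∈ l.blocks, x ∈ l'.blocks) (hj : j ≤ j') : Avail N' q l' b j' := by
  rcases h with h | ⟨m, hmm, rfl, hq, hc⟩
  · exact .inl (hl _ h)
  · rcases hm m hmm hq with h | h
    · exact .inr ⟨m, h, rfl, hq, hc.trans hj⟩
    · exact .inl h.2

/-- The invariant does not depend on the orders of the execution and of the buffer, the state of
the adversary, and the progress. -/
theorem Inv.congr {N N' : GlobalState P} {r d : Set Party} (h : Inv N r d)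
    (ho : N'.execOrder.Perm N.execOrder) (hc : N'.clock = N.clock)
    (hs : N'.stateMap = N.stateMap) (hm : ∀ m, m ∈ N'.msgBuff ↔ m ∈ N.msgBuff)
    (hh : N'.history = N.history) : Inv N' r d := by
  have hH : blockHistory N' = blockHistory N := by simp [blockHistory, hh]
  have hA : ∀ q l b j, Avail N' q l b j ↔ Avail N q l b j := fun q l b j => by
    simp only [Avail, hm]
  constructor
  · exact ho.trans h.order
  · rw [hc]; exact h.clock_pos
  · rw [hs]; exact h.some_of_mem
  · rw [hs]; exact h.of_some
  · rw [hs]; exact h.corrupt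
  · rw [hs, hH]; exact h.tree_sub
  · rw [hH]; intro m; rw [hm]; exact h.msg_sub m
  · simp only [hs, hA]; exact h.tree_avail
  · simp only [hs, hA, hm]; exact h.msg_avail
  · simp only [hs, hA, hH, hc]; exact h.honest_chain
  · simp only [hm]; exact h.due
  · rw [hc, hH]; exact h.honest_slot
  · rw [hH]; exact h.unique
  · rw [hc, hH]; exact h.baked
  · rw [hc, hH]; exact h.not_baked

theorem mem_blockHistory_floodMsgsAdv (ms : List (Message Party Hash Tx × DelayMap Party))
    (N : GlobalState P) (b : Block Party Hash Tx) :
    b ∈ blockHistory (floodMsgsAdv ms N) ↔ b ∈ blockHistory N ∨ ∃ m ∈ ms, m.1.block = b := by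
  simp [blockHistory, floodMsgsAdv, or_assoc]

theorem mem_msgBuff_floodMsgsAdv {ms : List (Message Party Hash Tx × DelayMap Party)}
    {N : GlobalState P} {m : MsgTuple Party Hash Tx} :
    m ∈ (floodMsgsAdv ms N).msgBuff ↔ m ∈ N.msgBuff ∨
      ∃ a ∈ ms, ∃ p ∈ N.execOrder, (⟨a.1, p, (a.2 p).toNat⟩ : MsgTuple Party Hash Tx) = m := by
  simp [floodMsgsAdv]

theorem Delay.one_le_toNat (x : Delay) : 1 ≤ x.toNat := by cases x <;> simp [Delay.toNat]

theorem Delay.toNat_le_two (x : Delay) : x.toNat ≤ 2 := by cases x <;> simp [Delay.toNat]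

theorem Inv.floodMsgsAdv {N : GlobalState P} {r d : Set Party} (h : Inv N r d)
    {ms : List (Message Party Hash Tx × DelayMap Party)} (hms : NoForgery ms N) :
    Inv (floodMsgsAdv ms N) r d := by
  have hH := mem_blockHistory_floodMsgsAdv ms N
  have hsub : ∀ b ∈ blockHistory N, b ∈ blockHistory (NSB.floodMsgsAdv ms N) :=
    fun b hb => (hH b).2 (.inl hb)
  have hhon : ∀ b ∈ blockHistory (NSB.floodMsgsAdv ms N), P.honest b.bid = true →
      b ∈ blockHistory N := by
    intro b hb hh
    rcases (hH b).1 hb with hb | ⟨m, hm, rfl⟩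
    · exact hb
    · exact hms m hm hh
  have hA : ∀ {q l b j}, Avail N q l b j → Avail (NSB.floodMsgsAdv ms N) q l b j :=
    fun h => h.mono (fun m hm _ => .inl (mem_msgBuff_floodMsgsAdv.2 (.inl hm)))
      (fun _ => id) le_rfl
  constructor
  · exact h.order
  · exact h.clock_pos
  · exact h.some_of_mem
  · exact h.of_some
  · exact h.corrupt
  · exact fun p l hp b hb => hsub b (h.tree_sub p l hp b hb)
  · intro m hm
    rcases mem_msgBuff_floodMsgsAdv.1 hm with hm | ⟨a, ha, p, hp, rfl⟩
    · exact hsub _ (h.msg_sub m hm)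
    · exact (hH _).2 (.inr ⟨a, ha, rfl⟩)
  · exact fun p l hp hp' q l' hq hq' b hb => hA (h.tree_avail p l hp hp' q l' hq hq' b hb)
  · intro m hm q l' hq hq'
    rcases mem_msgBuff_floodMsgsAdv.1 hm with hm | ⟨a, ha, p, hp, rfl⟩
    · exact hA (h.msg_avail m hm q l' hq hq')
    · refine .inr ⟨⟨a.1, q, (a.2 q).toNat⟩, mem_msgBuff_floodMsgsAdv.2 (.inr ⟨a, ha, q,
        h.order.mem_iff.2 (h.of_some q l' hq).1, rfl⟩), rfl, rfl, ?_⟩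
      have := (a.2 q).toNat_le_two
      have := (a.2 p).one_le_toNat
      simp only
      omega
  · intro b hb hh
    obtain ⟨c, hc, hc'⟩ := h.honest_chain b (hhon b hb hh) hh
    refine ⟨c, hc.mono hsub fun x hx hx' _ => hhon x hx hx', fun q l' hq hq' x hx => ?_⟩
    exact ⟨hA (hc' q l' hq hq' x hx).1, (hc' q l' hq hq' x hx).2⟩
  · intro m hm hr
    rcases mem_msgBuff_floodMsgsAdv.1 hm with hm | ⟨a, ha, p, hp, rfl⟩
    · exact h.due m hm hr
    · have := (a.2 p).one_le_toNat
      simp only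
      omega
  · exact fun b hb hh => h.honest_slot b (hhon b hb hh) hh
  · intro b hb b' hb' hh h1 h2 h3
    exact h.unique b (hhon b hb hh) b' (hhon b' hb' (h3 ▸ hh)) hh h1 h2 h3
  · intro p hp hp' s hw h1 h2
    obtain ⟨b, hb, hb'⟩ := h.baked p hp hp' s hw h1 h2
    exact ⟨b, hsub b hb, hb'⟩
  · exact fun b hb hh h1 => h.not_baked b (hhon b hb hh) hh h1

/-- Removing the messages due for `p` from the buffer, with or without delivering them, provided
that they reach the tree of `p` if `p` is honest. -/
theorem Inv.deliver {N N' : GlobalState P} {r d : Set Party} (h : Inv N r d) (p : Party)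
    (ho : N'.execOrder = N.execOrder) (hc : N'.clock = N.clock) (hh : N'.history = N.history)
    (hm : ∀ m, m ∈ N'.msgBuff ↔ m ∈ N.msgBuff ∧ ¬ (m.rcv = p ∧ m.cd = 0))
    (hs : ∀ q l, N.stateMap q = some l → ∃ l', N'.stateMap q = some l')
    (hs' : ∀ q l', N'.stateMap q = some l' → ∃ l, N.stateMap q = some l ∧ l'.id = l.id ∧
      ∀ b, b ∈ l'.blocks ↔ b ∈ l.blocks ∨ q = p ∧ P.honest p = true ∧
        ∃ m ∈ N.msgBuff, m.rcv = p ∧ m.cd = 0 ∧ m.msg.block = b) :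
    Inv N' (insert p r) d := by
  have hH : blockHistory N' = blockHistory N := by simp [blockHistory, hh]
  have hA : ∀ q l', N'.stateMap q = some l' → P.honest q = true → ∃ l, N.stateMap q = some l ∧
      (∀ b ∈ l.blocks, b ∈ l'.blocks) ∧ ∀ b j, Avail N q l b j → Avail N' q l' b j := by
    intro q l' hq hq'
    obtain ⟨l, hl, -, hb⟩ := hs' q l' hq
    refine ⟨l, hl, fun b h => (hb b).2 (.inl h), fun b j h => h.mono (fun m hmm hmq => ?_)
      (fun b h => (hb b).2 (.inl h)) le_rfl⟩
    by_cases hp : m.rcv = p ∧ m.cd = 0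
    · have hqp : q = p := hmq.symm.trans hp.1
      exact .inr ⟨hp.2, (hb _).2 (.inr ⟨hqp, hqp ▸ hq', m, hmm, hp.1, hp.2, rfl⟩)⟩
    · exact .inl ((hm m).2 ⟨hmm, hp⟩)
  constructor
  · rw [ho]; exact h.order
  · rw [hc]; exact h.clock_pos
  · intro q hq
    obtain ⟨l, hl⟩ := h.some_of_mem q hq
    exact hs q l hl
  · intro q l' hq
    obtain ⟨l, hl, hi, -⟩ := hs' q l' hq
    rw [hi]
    exact h.of_some q l hl
  · intro q l' hq hq' b hb
    obtain ⟨l, hl, -, hbl⟩ := hs' q l' hq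
    rcases (hbl b).1 hb with hb | ⟨rfl, hp, -⟩
    · exact h.corrupt q l hl hq' b hb
    · simp [hq'] at hp
  · intro q l' hq b hb
    obtain ⟨l, hl, -, hbl⟩ := hs' q l' hq
    rw [hH]
    rcases (hbl b).1 hb with hb | ⟨-, -, m, hmm, -, -, rfl⟩
    · exact h.tree_sub q l hl b hb
    · exact h.msg_sub m hmm
  · intro m hmm
    rw [hH]
    exact h.msg_sub m ((hm m).1 hmm).1
  · intro q₁ l₁ hq₁ hq₁' q l' hq hq' b hb
    obtain ⟨l, hl, -, hA⟩ := hA q l' hq hq'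
    obtain ⟨l₀, hl₀, -, hbl⟩ := hs' q₁ l₁ hq₁
    rcases (hbl b).1 hb with hb | ⟨-, -, m, hmm, -, h0, rfl⟩
    · exact hA _ _ (h.tree_avail q₁ l₀ hl₀ hq₁' q l hl hq' b hb)
    · have := h.msg_avail m hmm q l hl hq'
      rw [h0] at this
      exact hA _ _ this
  · intro m hmm q l' hq hq'
    obtain ⟨l, hl, -, hA⟩ := hA q l' hq hq'
    exact hA _ _ (h.msg_avail m ((hm m).1 hmm).1 q l hl hq')
  · rw [hH, hc]
    intro b hb hh
    obtain ⟨c, hc, hc'⟩ := h.honest_chain b hb hh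
    refine ⟨c, hc, fun q l' hq hq' x hx => ?_⟩
    obtain ⟨l, hl, hll, hA⟩ := hA q l' hq hq'
    exact ⟨hA _ _ (hc' q l hl hq' x hx).1, fun hlt => hll _ ((hc' q l hl hq' x hx).2 hlt)⟩
  · intro m hmm hr h0
    rcases hr with hr | hr
    · exact ((hm m).1 hmm).2 ⟨hr, h0⟩
    · exact h.due m ((hm m).1 hmm).1 hr h0
  · rw [hc, hH]; exact h.honest_slot
  · rw [hH]; exact h.unique
  · rw [hc, hH]; exact h.baked
  · rw [hc, hH]; exact h.not_baked

theorem Inv.insert_of_not_winner {N : GlobalState P} {r d : Set Party} (h : Inv N r d) {p : Party}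
    (hp : P.honest p = true → P.winner p N.clock = false) : Inv N r (insert p d) := by
  refine { h with
    baked := fun q hq hq' s hw h1 h2 => ?_
    not_baked := fun b hb hh h1 => (h.not_baked b hb hh h1).imp_right fun h => .inr h }
  refine h.baked q hq hq' s hw h1 ?_
  rcases h2 with h2 | ⟨rfl, rfl | h3⟩
  · exact .inl h2
  · simp [hp hq'] at hw
  · exact .inr ⟨rfl, h3⟩

/-- Advancing the clock after all parties have been activated: as nothing that is due has been left
in the buffer, what was due for an honest party is in its tree. -/
theorem Inv.incrementSlot {N : GlobalState P} (h : Inv N {p | p ∈ P.initParties}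
    {p | p ∈ P.initParties}) (h0 : P.genesis.slot = 0) : Inv (incrementSlot N) ∅ ∅ := by
  have hA : ∀ q l b j, Avail N q l b j → Avail (NSB.incrementSlot N) q l b (j - 1) := by
    rintro q l b j (h1 | ⟨m, hm, h1, h2, h3⟩)
    · exact .inl h1
    · refine .inr ⟨{ m with cd := m.cd - 1 }, List.mem_map_of_mem hm, h1, h2, ?_⟩
      simp only
      omega
  have hpos := h.clock_pos
  constructor
  · exact h.order
  · exact h.clock_pos.trans (Nat.le_succ _)
  · exact h.some_of_mem
  · exact h.of_some
  · exact h.corrupt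
  · exact h.tree_sub
  · intro m hm
    obtain ⟨m', hm', rfl⟩ := List.mem_map.1 hm
    exact h.msg_sub m' hm'
  · intro p l hp hp' q l' hq hq' b hb
    exact (hA _ _ _ _ (h.tree_avail p l hp hp' q l' hq hq' b hb)).mono (fun _ hm _ => .inl hm)
      (fun _ => id) (Nat.zero_le _)
  · intro m hm q l' hq hq'
    obtain ⟨m', hm', rfl⟩ := List.mem_map.1 hm
    refine (hA _ _ _ _ (h.msg_avail m' hm' q l' hq hq')).mono (fun _ hm _ => .inl hm)
      (fun _ => id) ?_
    simp only
    omega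
  · intro b hb hh
    obtain ⟨c, hc, hc'⟩ := h.honest_chain b hb hh
    refine ⟨c, hc, fun q l' hq hq' x hx => ⟨?_, fun hlt => ?_⟩⟩
    · refine (hA _ _ _ _ (hc' q l' hq hq' x hx).1).mono (fun _ hm _ => .inl hm) (fun _ => id) ?_
      simp only [NSB.incrementSlot]
      omega
    · simp only [NSB.incrementSlot] at hlt
      rcases (hc' q l' hq hq' x hx).1 with h1 | ⟨m, hmm, -, hmp, hmc⟩
      · exact h1
      · exact absurd (by omega) (h.due m hmm (hmp ▸ (h.of_some q l' hq).1))
  · exact fun _ _ h => h.elim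
  · exact fun b hb hh => (h.honest_slot b hb hh).imp_right
      fun ⟨h1, h2, h3⟩ => ⟨h1, h2.trans (Nat.le_succ _), h3⟩
  · exact h.unique
  · rintro p hp hp' s hw h1 (h2 | h2)
    · refine h.baked p hp hp' s hw h1 ?_
      rcases Nat.lt_succ_iff_lt_or_eq.1 h2 with h2 | h2
      · exact .inl h2
      · exact .inr ⟨h2, hp⟩
    · exact h2.2.elim
  · intro b hb hh h1
    rcases h.honest_slot b hb hh with rfl | ⟨-, h2, -⟩
    · omega
    · exact .inl (Nat.lt_succ_of_le h2)

/-- The invariant, with the sets of activated parties that belong to the progress of the state. -/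
def ProgressInv (N : GlobalState P) : Prop :=
  match N.progress with
  | .ready => Inv N ∅ ∅
  | .delivered => Inv N {p | p ∈ P.initParties} ∅
  | .baked => Inv N {p | p ∈ P.initParties} {p | p ∈ P.initParties}

theorem ProgressInv.exists_inv {N : GlobalState P} (h : ProgressInv N) : ∃ r d, Inv N r d := by
  unfold ProgressInv at h
  split at h <;> exact ⟨_, _, h⟩

variable [DecidableEq Party]

theorem inv_initState (h0 : P.genesis.slot = 0)
    (hw : P.winner P.genesis.bid P.genesis.slot = true) : Inv (initState P) ∅ ∅ := by
  have hs : ∀ p l, (initState P).stateMap p = some l → p ∈ P.initParties ∧ l.id = p ∧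
      ∀ b, b ∈ l.blocks ↔ b = P.genesis := by
    intro p l h
    simp only [initState] at h
    split_ifs at h with hp
    cases h
    refine ⟨hp, rfl, fun b => ?_⟩
    have := (P.treeTypeMap p).instantiated b
    simpa [LocalState.blocks] using this
  have hH : ∀ b, b ∈ blockHistory (initState P) ↔ b = P.genesis := by
    simp [blockHistory, initState]
  have hA : ∀ q l j, (initState P).stateMap q = some l → Avail (initState P) q l P.genesis j :=
    fun q l j h => .inl (((hs q l h).2.2 _).2 rfl)
  constructor
  · exact List.Perm.refl _
  · exact le_rfl
  · intro p hp
    exact ⟨_, if_pos hp⟩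
  · exact fun p l h => ⟨(hs p l h).1, (hs p l h).2.1⟩
  · exact fun p l h _ b hb => ((hs p l h).2.2 b).1 hb
  · exact fun p l h b hb => (hH b).2 (((hs p l h).2.2 b).1 hb)
  · intro m hm
    simp [initState] at hm
  · intro p l h _ q l' h' _ b hb
    rw [((hs p l h).2.2 b).1 hb]
    exact hA q l' _ h'
  · intro m hm
    simp [initState] at hm
  · intro b hb _
    rw [(hH b).1 hb]
    refine ⟨[], ⟨⟨by simpa using hw, by simp, by simp, by simp⟩, by simp, ?_⟩, ?_⟩
    · intro b' hb' _ hlt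
      rw [(hH b').1 hb'] at hlt
      exact absurd hlt (lt_irrefl _)
    · intro q l hq _ x hx
      rw [List.mem_singleton.1 hx]
      exact ⟨hA q l _ hq, fun _ => ((hs q l hq).2.2 _).2 rfl⟩
  · intro m hm
    simp [initState] at hm
  · exact fun b hb _ => .inl ((hH b).1 hb)
  · intro b hb b' hb' _ _ _ _
    rw [(hH b).1 hb, (hH b').1 hb']
  · rintro p _ _ s _ h1 (h | h)
    · simp [initState] at h; omega
    · exact h.2.elim
  · intro b hb _ h1
    rw [(hH b).1 hb, h0] at h1
    omega

theorem Inv.rcvParty {N : GlobalState P} {r d : Set Party} (h : Inv N r d) {p : Party}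
    (hp : p ∈ P.initParties)
    (hf : P.honest p = false → NoForgery (advRcvOut (removeDue p N)).1 N) :
    Inv (rcvParty N p) (insert p r) d := by
  have hmem : ∀ m : MsgTuple Party Hash Tx, m ∈ (removeDue p N).msgBuff ↔
      m ∈ N.msgBuff ∧ ¬ (m.rcv = p ∧ m.cd = 0) := by
    simp only [removeDue, List.mem_filter, decide_eq_true_eq, implies_true]
  unfold NSB.rcvParty
  split_ifs with hhon
  · obtain ⟨l, hl⟩ := h.some_of_mem p hp
    rw [hl]
    refine h.deliver p rfl rfl rfl hmem ?_ ?_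
    · intro q l' hq
      by_cases hqp : q = p
      · subst hqp
        exact ⟨_, Function.update_self _ _ _⟩
      · exact ⟨l', (Function.update_of_ne hqp _ _).trans hq⟩
    · intro q l' hq
      by_cases hqp : q = p
      · subst hqp
        have e : l' = honestRcv (dueMsgs q N) l := by
          simpa [setLocal, eq_comm] using hq
        subst e
        refine ⟨l, hl, honestRcv_id _ _, fun b => ?_⟩
        rw [mem_blocks_honestRcv]
        simp [dueMsgs, hhon, and_assoc]
      · have : N.stateMap q = some l' := (Function.update_of_ne hqp _ _).symm.trans hq
        exact ⟨l', this, rfl, fun b => by simp [hqp]⟩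
  · have hhon' : P.honest p = false := by simpa using hhon
    refine Inv.floodMsgsAdv ?_ (hf hhon')
    exact h.deliver p rfl rfl rfl hmem (fun q l hq => ⟨l, hq⟩)
      fun q l' hq => ⟨l', hq, rfl, fun b => by simp [hhon']⟩

/-- An honest winner bakes: the best chain of its tree is longer than the chains of all honest
blocks from earlier slots, because these are in its tree. -/
theorem Inv.bakeHonest {N : GlobalState P} {r d : Set Party} (h : Inv N r d) {p : Party}
    {l : LocalState.{u₁, u₂, u₃, v} P.toChainParams} (hl : N.stateMap p = some l)
    (hhon : P.honest p = true) (hr : p ∈ r) (hd : p ∉ d) (hw : P.winner p N.clock = true)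
    (h0 : P.genesis.slot = 0)
    {B : Block Party Hash Tx} (hB : B = ⟨P.hashBlock ((l.bestChain (N.clock - 1)).headD P.genesis),
      N.clock, P.txSelection N.clock p, p⟩) :
    Inv (floodMsgs [.blockMsg B] (setLocal p (l.extend B) N)) r (insert p d) := by
  have hpos := h.clock_pos
  have hBs : B.slot = N.clock := by rw [hB]
  have hBp : B.bid = p := by rw [hB]
  set N' := floodMsgs [.blockMsg B] (setLocal p (l.extend B) N) with hN'
  have hH : ∀ b, b ∈ blockHistory N' ↔ b ∈ blockHistory N ∨ b = B := by
    simp [blockHistory, hN', floodMsgs, setLocal, Message.block, or_assoc]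
  have hsub : ∀ b ∈ blockHistory N, b ∈ blockHistory N' := fun b hb => (hH b).2 (.inl hb)
  have hm : ∀ m, m ∈ N'.msgBuff ↔ m ∈ N.msgBuff ∨
      ∃ q ∈ P.initParties, (⟨.blockMsg B, q, 1⟩ : MsgTuple Party Hash Tx) = m := by
    simp [hN', floodMsgs, setLocal, h.order.mem_iff]
  have hs : ∀ q l', N'.stateMap q = some l' → ∃ l₀, N.stateMap q = some l₀ ∧ l'.id = l₀.id ∧
      ∀ b, b ∈ l'.blocks ↔ b ∈ l₀.blocks ∨ q = p ∧ b = B := by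
    intro q l' hq
    by_cases hqp : q = p
    · subst hqp
      have e : l' = l.extend B := by
        simpa [hN', floodMsgs, setLocal, eq_comm] using hq
      subst e
      refine ⟨l, hl, rfl, fun b => ?_⟩
      rw [LocalState.mem_blocks_extend]
      simp
    · have : N.stateMap q = some l' := (Function.update_of_ne hqp _ _).symm.trans hq
      exact ⟨l', this, rfl, fun b => by simp [hqp]⟩
  have hA : ∀ q l', N'.stateMap q = some l' → ∃ l₀, N.stateMap q = some l₀ ∧
      (∀ b ∈ l₀.blocks, b ∈ l'.blocks) ∧ ∀ b j, Avail N q l₀ b j → Avail N' q l' b j := by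
    intro q l' hq
    obtain ⟨l₀, hl₀, -, hb⟩ := hs q l' hq
    exact ⟨l₀, hl₀, fun b h => (hb b).2 (.inl h), fun b j h => h.mono
      (fun m hmm _ => .inl ((hm m).2 (.inl hmm))) (fun b h => (hb b).2 (.inl h)) le_rfl⟩
  have hAB : ∀ q l' j, N'.stateMap q = some l' → 1 ≤ j → Avail N' q l' B j := by
    intro q l' j hq hj
    obtain ⟨l₀, hl₀, -⟩ := hA q l' hq
    exact .inr ⟨_, (hm _).2 (.inr ⟨q, (h.of_some q l₀ hl₀).1, rfl⟩), rfl, rfl, hj⟩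
  have hvalid : ValidChain P.toChainParams (B :: l.bestChain (N.clock - 1)) := by
    refine (l.bestChain_valid _).cons (by rw [hBp, hBs]; exact hw) (by rw [hB]) fun x hx => ?_
    have := l.slot_le_of_mem_bestChain hx
    omega
  have hold : ∀ b ∈ blockHistory N, P.honest b.bid = true → b.slot ≤ N.clock := by
    intro b hb hb'
    rcases h.honest_slot b hb hb' with rfl | ⟨-, h, -⟩ <;> omega
  constructor
  · exact h.order
  · exact h.clock_pos
  · intro q hq
    by_cases hqp : q = p
    · subst hqp
      exact ⟨_, Function.update_self _ _ _⟩
    · obtain ⟨l', hl'⟩ := h.some_of_mem q hq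
      exact ⟨l', (Function.update_of_ne hqp _ _).trans hl'⟩
  · intro q l' hq
    obtain ⟨l₀, hl₀, hi, -⟩ := hs q l' hq
    rw [hi]
    exact h.of_some q l₀ hl₀
  · intro q l' hq hq' b hb
    obtain ⟨l₀, hl₀, -, hbl⟩ := hs q l' hq
    rcases (hbl b).1 hb with hb | ⟨rfl, -⟩
    · exact h.corrupt q l₀ hl₀ hq' b hb
    · simp [hq'] at hhon
  · intro q l' hq b hb
    obtain ⟨l₀, hl₀, -, hbl⟩ := hs q l' hq
    rcases (hbl b).1 hb with hb | ⟨-, rfl⟩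
    · exact hsub b (h.tree_sub q l₀ hl₀ b hb)
    · exact (hH _).2 (.inr rfl)
  · intro m hmm
    rcases (hm m).1 hmm with hmm | ⟨q, -, rfl⟩
    · exact hsub _ (h.msg_sub m hmm)
    · exact (hH _).2 (.inr rfl)
  · intro q₁ l₁ hq₁ hq₁' q l' hq hq' b hb
    obtain ⟨l₀, hl₀, -, hbl⟩ := hs q₁ l₁ hq₁
    rcases (hbl b).1 hb with hb | ⟨-, rfl⟩
    · obtain ⟨l₂, hl₂, -, hA⟩ := hA q l' hq
      exact hA _ _ (h.tree_avail q₁ l₀ hl₀ hq₁' q l₂ hl₂ hq' b hb)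
    · exact hAB q l' 1 hq le_rfl
  · intro m hmm q l' hq hq'
    rcases (hm m).1 hmm with hmm | ⟨q', -, rfl⟩
    · obtain ⟨l₂, hl₂, -, hA⟩ := hA q l' hq
      exact hA _ _ (h.msg_avail m hmm q l₂ hl₂ hq')
    · exact hAB q l' _ hq (by simp)
  · intro b hb hh
    change ∃ c, _ ∧ ∀ q l', _ → _ → ∀ x ∈ b :: c,
      Avail N' q l' x (b.slot + 1 - N.clock) ∧ (b.slot + 1 < N.clock → x ∈ l'.blocks)
    rcases (hH b).1 hb with hbN | rfl
    · obtain ⟨c, hc, hc'⟩ := h.honest_chain b hbN hh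
      refine ⟨c, hc.mono hsub fun x hx _ hxs => ?_, fun q l' hq hq' x hx => ?_⟩
      · rcases (hH x).1 hx with hx | rfl
        · exact hx
        · have := hold b hbN hh
          omega
      · obtain ⟨l₂, hl₂, hll, hA⟩ := hA q l' hq
        exact ⟨hA _ _ (hc' q l₂ hl₂ hq' x hx).1,
          fun hlt => hll _ ((hc' q l₂ hl₂ hq' x hx).2 hlt)⟩
    · refine ⟨l.bestChain (N.clock - 1), ⟨hvalid, fun x hx => ?_, fun b' hb' hh' hs' => ?_⟩,
        fun q l' hq hq' x hx => ⟨?_, fun hlt => by omega⟩⟩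
      · exact hsub x (h.tree_sub p l hl x (l.mem_blocks_of_mem_bestChain hx))
      · rcases (hH b').1 hb' with hb' | rfl
        · obtain ⟨c, hc, hc'⟩ := h.honest_chain b' hb' hh'
          refine ⟨c, hc.valid, fun x hx => hsub x (hc.sub x hx), ?_⟩
          refine Nat.lt_of_succ_le (l.length_le_bestChain hc.valid (fun x hx => ?_) fun x hx => ?_)
          · rcases (hc' p l hl hhon x hx).1 with h1 | ⟨m, hmm, -, hmp, hmc⟩
            · exact h1
            · exact absurd (by omega) (h.due m hmm (hmp ▸ hr))
          · have := hc.valid.slot_le hx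
            omega
        · omega
      · rcases List.mem_cons.1 hx with rfl | hx
        · exact hAB q l' _ hq (by omega)
        · obtain ⟨l₂, hl₂, -, hA⟩ := hA q l' hq
          have := hA _ _ (h.tree_avail p l hl hhon q l₂ hl₂ hq' x
            (l.mem_blocks_of_mem_bestChain hx))
          rwa [hBs, Nat.add_sub_cancel_left]
  · intro m hmm hmr
    rcases (hm m).1 hmm with hmm | ⟨q', -, rfl⟩
    · exact h.due m hmm hmr
    · simp
  · intro b hb hh
    change _ ∨ 1 ≤ b.slot ∧ b.slot ≤ N.clock ∧ _
    rcases (hH b).1 hb with hb | rfl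
    · exact h.honest_slot b hb hh
    · exact .inr ⟨by omega, by omega, hBp ▸ (h.of_some p l hl).1⟩
  · -- `p` has not baked in this slot before, so `B` differs from the old blocks in slot or baker.
    have hnew : ∀ b ∈ blockHistory N, b.slot = B.slot → b.bid = B.bid → False := by
      intro b hb h1 h2
      rcases h.not_baked b hb (by rw [h2, hBp]; exact hhon) (by omega) with h3 | h3
      · omega
      · rw [h2, hBp] at h3
        exact hd h3
    intro b hb b' hb' hh h1 h2 h3
    rcases (hH b).1 hb with hbN | rfl <;> rcases (hH b').1 hb' with hbN' | rfl
    · exact h.unique b hbN b' hbN' hh h1 h2 h3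
    · exact (hnew b hbN h2 h3).elim
    · exact (hnew b' hbN' h2.symm h3.symm).elim
    · rfl
  · intro q hq hq' s hws h1 h2
    change s < N.clock ∨ s = N.clock ∧ _ at h2
    by_cases hqs : q = p ∧ s = N.clock
    · exact ⟨B, (hH B).2 (.inr rfl), by rw [hBp, hqs.1], by rw [hBs, hqs.2]⟩
    · obtain ⟨b, hb, hb'⟩ := h.baked q hq hq' s hws h1 (by
        rcases h2 with h2 | ⟨h2, h3 | h3⟩
        · exact .inl h2
        · exact (hqs ⟨h3, h2⟩).elim
        · exact .inr ⟨h2, h3⟩)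
      exact ⟨b, hsub b hb, hb'⟩
  · intro b hb hh h1
    change b.slot < N.clock ∨ _
    rcases (hH b).1 hb with hb | rfl
    · exact (h.not_baked b hb hh h1).imp_right fun h => .inr h
    · exact .inr (.inl hBp)

theorem Inv.bakeParty {N : GlobalState P} {r d : Set Party} (h : Inv N r d) {p : Party}
    (hp : p ∈ P.initParties) (hr : p ∈ r) (hd : p ∉ d) (h0 : P.genesis.slot = 0)
    (hf : P.honest p = false → NoForgery (advBakeOut N).1 N) :
    Inv (bakeParty N p) r (insert p d) := by
  unfold NSB.bakeParty
  split_ifs with hhon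
  · obtain ⟨l, hl⟩ := h.some_of_mem p hp
    have hid : l.id = p := (h.of_some p l hl).2
    rw [hl]
    by_cases hw : P.winner p N.clock = true
    · simp only [honestBake, hid, hw, if_true]
      exact h.bakeHonest hl hhon hr hd hw h0 rfl
    · simp only [honestBake, hid, hw]
      refine (h.insert_of_not_winner (p := p) fun _ => by simpa using hw).congr (List.Perm.refl _)
        rfl ?_ (by simp [floodMsgs, setLocal]) (by simp [floodMsgs, setLocal])
      exact Function.update_eq_self_iff.2 hl.symm
  · have hhon' : P.honest p = false := by simpa using hhon
    refine Inv.floodMsgsAdv ?_ (hf hhon')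
    exact (h.insert_of_not_winner (p := p) fun h => by simp [h] at hhon).congr (List.Perm.refl _)
      rfl rfl (fun _ => Iff.rfl) rfl

theorem Inv.receiveAll {N : GlobalState P} (h : Inv N ∅ ∅)
    (hf : ∀ pre p post, N.execOrder = pre ++ p :: post → P.honest p = false →
      NoForgery (advRcvOut (removeDue p (pre.foldl NSB.rcvParty N))).1
        (pre.foldl NSB.rcvParty N)) :
    Inv (receiveAll N) {p | p ∈ P.initParties} ∅ := by
  have key : ∀ pre post, N.execOrder = pre ++ post →
      Inv (pre.foldl NSB.rcvParty N) {p | p ∈ pre} ∅ := by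
    intro pre
    induction pre using List.reverseRecOn with
    | nil =>
      intro _ _
      simpa using h
    | append_singleton pre p ih =>
      intro post e
      rw [List.append_assoc] at e
      have hp : p ∈ P.initParties := h.order.mem_iff.1 (by rw [e]; simp)
      have := (ih _ e).rcvParty hp (hf pre p post e)
      rw [List.foldl_append]
      have hset : {q | q ∈ pre ++ [p]} = insert p {q | q ∈ pre} := by
        ext q
        simp [or_comm]
      rw [hset]
      exact this
  have := key N.execOrder [] (by simp)
  simp only [h.order.mem_iff] at this
  exact this.congr (List.Perm.refl _) rfl rfl (fun _ => Iff.rfl) rfl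

theorem Inv.bakeAll {N : GlobalState P} (h : Inv N {p | p ∈ P.initParties} ∅)
    (hnd : P.initParties.Nodup) (h0 : P.genesis.slot = 0)
    (hf : ∀ pre p post, N.execOrder = pre ++ p :: post → P.honest p = false →
      NoForgery (advBakeOut (pre.foldl NSB.bakeParty N)).1 (pre.foldl NSB.bakeParty N)) :
    Inv (bakeAll N) {p | p ∈ P.initParties} {p | p ∈ P.initParties} := by
  have key : ∀ pre post, N.execOrder = pre ++ post →
      Inv (pre.foldl NSB.bakeParty N) {p | p ∈ P.initParties} {p | p ∈ pre} := by
    intro pre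
    induction pre using List.reverseRecOn with
    | nil =>
      intro _ _
      simpa using h
    | append_singleton pre p ih =>
      intro post e
      have hd : p ∉ pre := by
        have hnd' := h.order.nodup_iff.2 hnd
        rw [e, List.nodup_append] at hnd'
        have := List.nodup_append.1 hnd'.1
        exact fun hp => this.2.2 p hp p (by simp) rfl
      rw [List.append_assoc] at e
      have hp : p ∈ P.initParties := h.order.mem_iff.1 (by rw [e]; simp)
      have := (ih _ e).bakeParty hp hp hd h0 (hf pre p post e)
      rw [List.foldl_append]
      have hset : {q | q ∈ pre ++ [p]} = insert p {q | q ∈ pre} := by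
        ext q
        simp [or_comm]
      rw [hset]
      exact this
  have := key N.execOrder [] (by simp)
  simp only [h.order.mem_iff] at this
  exact this.congr (List.Perm.refl _) rfl rfl (fun _ => Iff.rfl) rfl

theorem progressInv_of_reachable (h0 : P.genesis.slot = 0)
    (hw : P.winner P.genesis.bid P.genesis.slot = true) (hnd : P.initParties.Nodup)
    {M N : GlobalState P} (hM : Reachable (initState P) M) (hN : Reachable M N)
    (hf : ForgingFree N) : ProgressInv M := by
  induction hM with
  | refl => exact inv_initState h0 hw
  | @tail L M hL hs ih =>
    have hLi := ih (.head hs hN)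
    cases hs with
    | receive hp =>
      rw [ProgressInv, hp] at hLi
      exact hLi.receiveAll fun pre p post e hc => (hf L pre p post hL e hc).1 hp hN
    | bake hp =>
      rw [ProgressInv, hp] at hLi
      exact hLi.bakeAll hnd h0 fun pre p post e hc => (hf L pre p post hL e hc).2 hp hN
    | increment hp =>
      rw [ProgressInv, hp] at hLi
      exact hLi.incrementSlot h0
    | permuteExecOrder o ho =>
      unfold ProgressInv at hLi ⊢
      split at hLi <;> rename_i hp <;> simp only [hp] <;>
        exact hLi.congr ho rfl rfl (fun _ => Iff.rfl) rfl
    | permuteMsgBuff ms hms =>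
      unfold ProgressInv at hLi ⊢
      split at hLi <;> rename_i hp <;> simp only [hp] <;>
        exact hLi.congr (List.Perm.refl _) rfl rfl (fun _ => hms.mem_iff) rfl

end Invariant

/-! ### Growth of the clock and the history -/

section Monotonicity

variable {Party : Type u₁} {Hash : Type u₂} {Tx : Type u₃}
  {P : Protocol.{u₁, u₂, u₃, v, w} Party Hash Tx}

theorem foldl_mono {f : GlobalState P → Party → GlobalState P}
    (hc : ∀ N p, (f N p).clock = N.clock) (hh : ∀ N p, N.history ⊆ (f N p).history)
    (ps : List Party) (N : GlobalState P) :
    (ps.foldl f N).clock = N.clock ∧ N.history ⊆ (ps.foldl f N).history := by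
  induction ps generalizing N with
  | nil => exact ⟨rfl, List.Subset.refl _⟩
  | cons p ps ih =>
    exact ⟨(ih (f N p)).1.trans (hc N p), List.Subset.trans (hh N p) (ih (f N p)).2⟩

variable [DecidableEq Party]

theorem clock_rcvParty (N : GlobalState P) (p : Party) : (rcvParty N p).clock = N.clock := by
  unfold rcvParty
  split_ifs
  · split <;> rfl
  · rfl

theorem history_subset_rcvParty (N : GlobalState P) (p : Party) :
    N.history ⊆ (rcvParty N p).history := by
  unfold rcvParty
  split_ifs
  · split <;> exact List.Subset.refl _
  · exact List.subset_append_left _ _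

theorem clock_bakeParty (N : GlobalState P) (p : Party) : (bakeParty N p).clock = N.clock := by
  unfold bakeParty
  split_ifs
  · split <;> rfl
  · rfl

theorem history_subset_bakeParty (N : GlobalState P) (p : Party) :
    N.history ⊆ (bakeParty N p).history := by
  unfold bakeParty
  split_ifs
  · split
    · exact List.subset_append_left _ _
    · exact List.Subset.refl _
  · exact List.subset_append_left _ _

theorem Step.mono {N N' : GlobalState P} (h : Step N N') :
    N.clock ≤ N'.clock ∧ N.history ⊆ N'.history := by
  cases h with
  | receive _ =>
    have := foldl_mono clock_rcvParty history_subset_rcvParty N.execOrder N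
    exact ⟨this.1.ge, this.2⟩
  | bake _ =>
    have := foldl_mono clock_bakeParty history_subset_bakeParty N.execOrder N
    exact ⟨this.1.ge, this.2⟩
  | increment _ => exact ⟨Nat.le_succ _, List.Subset.refl _⟩
  | permuteExecOrder o _ => exact ⟨le_rfl, List.Subset.refl _⟩
  | permuteMsgBuff ms _ => exact ⟨le_rfl, List.Subset.refl _⟩

theorem Reachable.mono {N N' : GlobalState P} (h : Reachable N N') :
    N.clock ≤ N'.clock ∧ N.history ⊆ N'.history := by
  induction h with
  | refl => exact ⟨le_rfl, List.Subset.refl _⟩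
  | tail _ hs ih => exact ⟨ih.1.trans hs.mono.1, List.Subset.trans ih.2 hs.mono.2⟩

theorem Reachable.blockHistory_subset {N N' : GlobalState P} (h : Reachable N N') :
    blockHistory N ⊆ blockHistory N' :=
  List.cons_subset_cons _ (List.map_subset _ h.mono.2)

end Monotonicity

/-! ### Heights of honest blocks -/

section HonestBlocks

variable {Party : Type u₁} {Hash : Type u₂} {Tx : Type u₃}
  {P : Protocol.{u₁, u₂, u₃, v, w} Party Hash Tx} {N : GlobalState P} {r d : Set Party}

/-- Heights of honest blocks strictly increase with their slots. -/
theorem Inv.length_lt (h : Inv N r d) (hcf : CollisionFree N) (h0 : P.genesis.slot = 0)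
    {b b' : Block Party Hash Tx} {c c' : Chain Party Hash Tx}
    (hb : b ∈ blockHistory N) (hh : P.honest b.bid = true)
    (hb' : b' ∈ blockHistory N) (hh' : P.honest b'.bid = true)
    (hc : ValidChain P.toChainParams (b :: c)) (hs : ∀ x ∈ c, x ∈ blockHistory N)
    (hc' : ValidChain P.toChainParams (b' :: c')) (hs' : ∀ x ∈ c', x ∈ blockHistory N)
    (hlt : b'.slot < b.slot) : c'.length < c.length := by
  obtain ⟨e, he, -⟩ := h.honest_chain b hb hh
  obtain ⟨e', hv', hsub', hl⟩ := he.growth b' hb' hh' hlt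
  rw [hc.eq_of_head_eq hcf h0 he.valid hs he.sub, hc'.eq_of_head_eq hcf h0 hv' hs' hsub']
  exact hl

/-- Honest blocks of the same height are from the same slot. -/
theorem Inv.slot_eq (h : Inv N r d) (hcf : CollisionFree N) (h0 : P.genesis.slot = 0)
    {b b' : Block Party Hash Tx} {c c' : Chain Party Hash Tx}
    (hb : b ∈ blockHistory N) (hh : P.honest b.bid = true)
    (hb' : b' ∈ blockHistory N) (hh' : P.honest b'.bid = true)
    (hc : ValidChain P.toChainParams (b :: c)) (hs : ∀ x ∈ c, x ∈ blockHistory N)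
    (hc' : ValidChain P.toChainParams (b' :: c')) (hs' : ∀ x ∈ c', x ∈ blockHistory N)
    (hl : c.length = c'.length) : b.slot = b'.slot := by
  rcases lt_trichotomy b.slot b'.slot with hlt | he | hlt
  · have := h.length_lt hcf h0 hb' hh' hb hh hc' hs' hc hs hlt
    omega
  · exact he
  · have := h.length_lt hcf h0 hb hh hb' hh' hc hs hc' hs' hlt
    omega

theorem Inv.eq_of_superSlot (h : Inv N r d) (h0 : P.genesis.slot = 0)
    {b b' : Block Party Hash Tx} (hb : b ∈ blockHistory N) (hh : P.honest b.bid = true)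
    (hb' : b' ∈ blockHistory N) (hh' : P.honest b'.bid = true)
    (hsup : SuperSlot P b.slot) (hpos : 1 ≤ b.slot) (he : b.slot = b'.slot) : b = b' := by
  have key : ∀ x ∈ blockHistory N, P.honest x.bid = true → 1 ≤ x.slot →
      x.bid ∈ P.initParties ∧ P.winner x.bid x.slot = true ∧ P.honest x.bid = true := by
    intro x hx hxh hx1
    obtain ⟨c, hc, -⟩ := h.honest_chain x hx hxh
    refine ⟨?_, hc.valid.valid x (by simp), hxh⟩
    rcases h.honest_slot x hx hxh with rfl | ⟨-, -, hm⟩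
    · omega
    · exact hm
  refine h.unique b hb b' hb' hh hpos he (hsup.unique (key b hb hh hpos) ?_)
  rw [he]
  exact key b' hb' hh' (he ▸ hpos)

theorem Inv.exists_of_superSlot (h : Inv N r d) {s : ℕ} (hsup : SuperSlot P s) (h1 : 1 ≤ s)
    (hs : s < N.clock) : ∃ b ∈ blockHistory N, P.honest b.bid = true ∧ b.slot = s := by
  obtain ⟨p, hp, hw, hh⟩ := hsup.exists
  obtain ⟨b, hb, rfl, hbs⟩ := h.baked p hp hh s hw h1 (.inl hs)
  exact ⟨b, hb, hh, hbs⟩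

theorem Inv.length_lt_bestChain (h : Inv N r d) {p : Party}
    {l : LocalState.{u₁, u₂, u₃, v} P.toChainParams} (hl : N.stateMap p = some l)
    (hp : P.honest p = true) {b : Block Party Hash Tx} (hb : b ∈ blockHistory N)
    (hh : P.honest b.bid = true) (hs : b.slot + 1 < N.clock) :
    ∃ c, ValidChain P.toChainParams (b :: c) ∧ (∀ x ∈ c, x ∈ blockHistory N) ∧
      c.length < (l.bestChain (N.clock - 1)).length := by
  obtain ⟨c, hc, hc'⟩ := h.honest_chain b hb hh
  refine ⟨c, hc.valid, hc.sub, Nat.lt_of_succ_le (l.length_le_bestChain hc.valid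
    (fun x hx => (hc' p l hl hp x hx).2 hs) fun x hx => ?_)⟩
  have := hc.valid.slot_le hx
  omega

end HonestBlocks

/-! ### Two chains and the super slots -/

section Counting

variable {Party : Type u₁} {Hash : Type u₂} {Tx : Type u₃}
  {P : Protocol.{u₁, u₂, u₃, v, w} Party Hash Tx} {N : GlobalState P} {r d : Set Party}

/-- The block of slot `σ` in the chain `c` has the same height as an honest block of slot `s`. -/
def Charged (N : GlobalState P) (c : Chain Party Hash Tx) (s σ : ℕ) : Prop :=
  ∃ x r, x :: r <:+ c ∧ x.slot = σ ∧ ∃ b c', b ∈ blockHistory N ∧ P.honest b.bid = true ∧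
    b.slot = s ∧ ValidChain P.toChainParams (b :: c') ∧ (∀ y ∈ c', y ∈ blockHistory N) ∧
    c'.length = r.length

theorem Inv.charged_subsingleton (h : Inv N r d) (hcf : CollisionFree N) (h0 : P.genesis.slot = 0)
    {c : Chain Party Hash Tx} (hc : ValidChain P.toChainParams c) {s s' σ : ℕ}
    (hs : Charged N c s σ) (hs' : Charged N c s' σ) : s = s' := by
  obtain ⟨x, t, hx, rfl, b, c₁, hb, hh, rfl, hv, hsub, hl⟩ := hs
  obtain ⟨x', t', hx', he, b', c₂, hb', hh', rfl, hv', hsub', hl'⟩ := hs'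
  obtain ⟨-, rfl⟩ := List.cons.inj (hc.suffix_unique hx hx' he.symm)
  exact h.slot_eq hcf h0 hb hh hb' hh' hv hsub hv' hsub' (hl.trans hl'.symm)

open Classical in
/-- The counting argument for two chains `c₁` and `c₂` which are at least as long as the chains of
the honest blocks of super slots up to `t - 2` and `u - 2`, respectively, when `c₂` has no honest
block from a slot later than `t - 2`. -/
theorem Inv.prune_suffix_or_numSuperSlots_le (h : Inv N r d) (hcf : CollisionFree N)
    (hgh : P.honest P.genesis.bid = true) (h0 : P.genesis.slot = 0)
    (hwinner : ∀ p sl, P.winner p sl = true → P.honest p = false → p ∈ P.initParties)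
    {c₁ c₂ : Chain Party Hash Tx} (hv₁ : ValidChain P.toChainParams c₁)
    (hv₂ : ValidChain P.toChainParams c₂) (hsub₁ : ∀ x ∈ c₁, x ∈ blockHistory N)
    (hsub₂ : ∀ x ∈ c₂, x ∈ blockHistory N) {t u : ℕ} (k : ℕ) (htu : t ≤ u) (hu : u ≤ N.clock)
    (hs₁ : ∀ x ∈ c₁, x.slot < t) (hs₂ : ∀ x ∈ c₂, x.slot < u)
    (hh₂ : ∀ x ∈ c₂, P.honest x.bid = true → x.slot + 1 < t)
    (hl₁ : ∀ b ∈ blockHistory N, P.honest b.bid = true → SuperSlot P b.slot → 1 ≤ b.slot →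
      b.slot + 1 < t → ∃ c, ValidChain P.toChainParams (b :: c) ∧
        (∀ x ∈ c, x ∈ blockHistory N) ∧ c.length < c₁.length)
    (hl₂ : ∀ b ∈ blockHistory N, P.honest b.bid = true → SuperSlot P b.slot → 1 ≤ b.slot →
      b.slot + 1 < u → ∃ c, ValidChain P.toChainParams (b :: c) ∧
        (∀ x ∈ c, x ∈ blockHistory N) ∧ c.length < c₂.length) :
    prune k c₁ <:+ c₂ ∨
      ∃ sl' ≤ k, numSuperSlots P sl' (u - 1) ≤ 2 * numAdvSlots P sl' u := by
  -- `A` is the highest honest block that the two chains have in common.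
  let Q : ℕ → Prop := fun n => ∃ x s, P.honest x.bid = true ∧ x :: s <:+ c₁ ∧ x :: s <:+ c₂ ∧
    s.length = n
  have hgen : ∀ {c : Chain Party Hash Tx}, ValidChain P.toChainParams c → [P.genesis] <:+ c := by
    intro c hc
    obtain ⟨ys, hys⟩ := List.getLast?_eq_some_iff.1 hc.ends
    exact ⟨ys, hys.symm⟩
  have hQ0 : Q 0 := ⟨P.genesis, [], hgh, hgen hv₁, hgen hv₂, rfl⟩
  obtain ⟨A, a, hAh, hA₁, hA₂, ha⟩ := Nat.findGreatest_spec (P := Q) (Nat.zero_le c₁.length) hQ0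
  have hmax : ∀ x s, P.honest x.bid = true → x :: s <:+ c₁ → x :: s <:+ c₂ →
      s.length ≤ a.length := by
    intro x s hx h1 h2
    rw [ha]
    refine Nat.le_findGreatest ?_ ⟨x, s, hx, h1, h2, rfl⟩
    have := h1.length_le
    simp only [List.length_cons] at this
    omega
  rcases le_or_gt k A.slot with hk | hk
  · exact .inl ((hv₁.prune_suffix hA₁ hk).trans hA₂)
  refine .inr ⟨A.slot + 1, hk, ?_⟩
  have hsubs : ∀ {c : Chain Party Hash Tx} {x s}, (∀ y ∈ c, y ∈ blockHistory N) → x :: s <:+ c →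
      x ∈ blockHistory N ∧ ∀ y ∈ s, y ∈ blockHistory N := fun hc hs =>
    ⟨hc _ (hs.subset List.mem_cons_self), fun y hy => hc y (hs.subset (List.mem_cons_of_mem _ hy))⟩
  unfold numSuperSlots numAdvSlots
  set T := (Finset.Ico (A.slot + 1) (u - 1)).filter (SuperSlot P) with hT
  set E := (Finset.Ico (A.slot + 1) u).filter (AdvSlot P) with hE
  have hAdv : ∀ {c : Chain Party Hash Tx} {x s}, ValidChain P.toChainParams c →
      (∀ y ∈ c, y.slot < u) → A :: a <:+ c → x :: s <:+ c → a.length < s.length →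
      P.honest x.bid = false → x.slot ∈ E := by
    intro c x s hc hcu hA hx hlt hxh
    have hxc : x ∈ c := hx.subset List.mem_cons_self
    rw [hE, Finset.mem_filter, Finset.mem_Ico]
    exact ⟨⟨hc.lt_slot_of_length_lt hA hx hlt, hcu x hxc⟩, x.bid,
      hwinner _ _ (hc.valid x hxc) hxh, hc.valid x hxc, hxh⟩
  have hcover : ∀ s ∈ T, (∃ σ ∈ E, Charged N c₁ s σ) ∨ ∃ σ ∈ E, Charged N c₂ s σ := by
    intro s hs
    rw [hT, Finset.mem_filter, Finset.mem_Ico] at hs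
    obtain ⟨⟨hs1, hs2⟩, hsup⟩ := hs
    obtain ⟨S, hS, hSh, rfl⟩ := h.exists_of_superSlot hsup (by omega) (by omega)
    obtain ⟨c, hc, hcs, hcl⟩ := hl₂ S hS hSh hsup (by omega) (by omega)
    have hac : a.length < c.length :=
      h.length_lt hcf h0 hS hSh (hsubs hsub₂ hA₂).1 hAh hc hcs (hv₂.suffix hA₂)
        (hsubs hsub₂ hA₂).2 hs1
    -- An honest block at the height of `S` is `S`, as the slot of `S` is a super slot.
    have hsame : ∀ {c' : Chain Party Hash Tx} {y q}, ValidChain P.toChainParams c' →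
        (∀ z ∈ c', z ∈ blockHistory N) → y :: q <:+ c' → q.length = c.length →
        P.honest y.bid = true → S :: c = y :: q := by
      intro c' y q hc' hsub' hy hq hyh
      have e := h.eq_of_superSlot h0 hS hSh (hsubs hsub' hy).1 hyh hsup (by omega)
        (h.slot_eq hcf h0 hS hSh (hsubs hsub' hy).1 hyh hc hcs (hc'.suffix hy)
          (hsubs hsub' hy).2 hq.symm)
      subst e
      rw [hc.eq_of_head_eq hcf h0 (hc'.suffix hy) hcs (hsubs hsub' hy).2]
    obtain ⟨x, q, hx, hq⟩ := exists_suffix_length hcl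
    by_cases hxh : P.honest x.bid = true
    · have e₂ := hsame hv₂ hsub₂ hx hq hxh
      have hSc₂ : S ∈ c₂ := hx.subset (e₂ ▸ List.mem_cons_self)
      obtain ⟨c', hc', hcs', hcl'⟩ := hl₁ S hS hSh hsup (by omega) (hh₂ S hSc₂ hSh)
      rw [hc'.eq_of_head_eq hcf h0 hc hcs' hcs] at hcl'
      obtain ⟨y, q', hy, hq'⟩ := exists_suffix_length hcl'
      by_cases hyh : P.honest y.bid = true
      · have e₁ := hsame hv₁ hsub₁ hy hq' hyh
        have := hmax S c hSh (e₁ ▸ hy) (e₂ ▸ hx)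
        omega
      · exact .inl ⟨y.slot, hAdv hv₁ (fun z hz => (hs₁ z hz).trans_le htu) hA₁ hy (by omega)
          (by simpa using hyh), y, q', hy, rfl, S, c, hS, hSh, rfl, hc, hcs, hq'.symm⟩
    · exact .inr ⟨x.slot, hAdv hv₂ hs₂ hA₂ hx (by omega) (by simpa using hxh),
        x, q, hx, rfl, S, c, hS, hSh, rfl, hc, hcs, hq.symm⟩
  have hcard : ∀ {c : Chain Party Hash Tx}, ValidChain P.toChainParams c →
      (T.filter fun s => ∃ σ ∈ E, Charged N c s σ).card ≤ E.card := by
    intro c hc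
    refine Finset.card_le_card_of_forall_subsingleton (Charged N c)
      (fun s hs => (Finset.mem_filter.1 hs).2) fun σ _ s hs s' hs' => ?_
    exact h.charged_subsingleton hcf h0 hc hs.2 hs'.2
  calc T.card ≤ ((T.filter fun s => ∃ σ ∈ E, Charged N c₁ s σ) ∪
        T.filter fun s => ∃ σ ∈ E, Charged N c₂ s σ).card := by
        refine Finset.card_le_card fun s hs => ?_
        rcases hcover s hs with hc | hc
        · exact Finset.mem_union_left _ (Finset.mem_filter.2 ⟨hs, hc⟩)
        · exact Finset.mem_union_right _ (Finset.mem_filter.2 ⟨hs, hc⟩)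
    _ ≤ _ := Finset.card_union_le _ _
    _ ≤ 2 * E.card := by
        have := hcard hv₁
        have := hcard hv₂
        omega

end Counting

end NSB

/-! ### The timed common prefix property -/

theorem mainTheorem1
    {Party : Type u₁} {Hash : Type u₂} {Tx : Type u₃} [DecidableEq Party]
    (P : NSB.Protocol.{u₁, u₂, u₃, v, w} Party Hash Tx)
    (hgenesis_honest : P.honest P.genesis.bid = true)
    (hgenesis_slot : P.genesis.slot = 0)
    (hinit : P.initParties.Nodup)
    (hwinner : ∀ p sl, P.winner p sl = true → P.honest p = false → p ∈ P.initParties)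
    (N₁ N₂ : NSB.GlobalState P)
    (hN₁ : NSB.Reachable (NSB.initState P) N₁)
    (hN₂ : NSB.Reachable N₁ N₂)
    (hforging : NSB.ForgingFree N₂)
    (hcollision : NSB.CollisionFree N₂)
    (p₁ p₂ : Party)
    (l₁ l₂ : NSB.LocalState.{u₁, u₂, u₃, v} P.toChainParams)
    (hp₁ : N₁.stateMap p₁ = some l₁)
    (hp₂ : N₂.stateMap p₂ = some l₂)
    (hp₂_honest : P.honest p₂ = true)
    (sl₁ sl₂ k : ℕ)
    (hsl₁ : N₁.clock = sl₁)
    (hsl₂ : N₂.clock = sl₂) :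
    NSB.ChainPrefix (NSB.prune k (l₁.bestChain (sl₁ - 1))) (l₂.bestChain (sl₂ - 1)) ∨
    ∃ sl' sl'' : ℕ, sl' ≤ k ∧ sl₁ ≤ sl'' ∧ sl'' ≤ sl₂ ∧
      NSB.numSuperSlots P sl' (sl'' - 1) ≤ 2 * NSB.numAdvSlots P sl' sl'' := by
  have hle : sl₁ ≤ sl₂ := by
    rw [← hsl₁, ← hsl₂]
    exact hN₂.mono.1
  rcases le_or_gt sl₁ 1 with h1 | h1
  · -- Before slot 2, there are no super slots to be counted.
    refine .inr ⟨0, sl₁, Nat.zero_le _, le_rfl, hle, ?_⟩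
    simp [NSB.numSuperSlots, Nat.sub_eq_zero_of_le h1]
  have hv₁ := l₁.bestChain_valid (sl₁ - 1)
  have hv₂ := l₂.bestChain_valid (sl₂ - 1)
  have hw : P.winner P.genesis.bid P.genesis.slot = true := hv₁.valid _ hv₁.genesis_mem
  obtain ⟨r₁, d₁, i₁⟩ :=
    (NSB.progressInv_of_reachable hgenesis_slot hw hinit hN₁ hN₂ hforging).exists_inv
  obtain ⟨r₂, d₂, i₂⟩ := (NSB.progressInv_of_reachable hgenesis_slot hw hinit (hN₁.trans hN₂)
    .refl hforging).exists_inv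
  cases hp₁_honest : P.honest p₁ with
  | false =>
    -- The tree of a corrupted party contains only the genesis block.
    have hg := fun b hb => i₁.corrupt p₁ l₁ hp₁ hp₁_honest b
      (l₁.mem_blocks_of_mem_bestChain (sl := sl₁ - 1) hb)
    have e : l₁.bestChain (sl₁ - 1) = [P.genesis] := by
      generalize l₁.bestChain (sl₁ - 1) = c at hv₁ hg
      match c, hv₁, hg with
      | [], hv, _ => exact (hv.ne_nil rfl).elim
      | [x], _, hg => rw [hg x (by simp)]
      | x :: y :: c, hv, hg =>
        have := hv.slot_lt (x := y) (by simp)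
        rw [hg x (by simp), hg y (by simp)] at this
        exact (lt_irrefl _ this).elim
    obtain ⟨ys, hys⟩ := List.getLast?_eq_some_iff.1 hv₂.ends
    exact .inl ⟨ys, by rw [e]; simp [NSB.prune, hgenesis_slot, hys]⟩
  | true =>
  have hsub₁ : ∀ x ∈ l₁.bestChain (sl₁ - 1), x ∈ NSB.blockHistory N₂ := fun x hx =>
    hN₂.blockHistory_subset (i₁.tree_sub p₁ l₁ hp₁ x (l₁.mem_blocks_of_mem_bestChain hx))
  have hsub₂ : ∀ x ∈ l₂.bestChain (sl₂ - 1), x ∈ NSB.blockHistory N₂ := fun x hx =>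
    i₂.tree_sub p₂ l₂ hp₂ x (l₂.mem_blocks_of_mem_bestChain hx)
  have hs₁ : ∀ x ∈ l₁.bestChain (sl₁ - 1), x.slot < sl₁ := fun x hx => by
    have := l₁.slot_le_of_mem_bestChain hx
    omega
  have hs₂ : ∀ x ∈ l₂.bestChain (sl₂ - 1), x.slot < sl₂ := fun x hx => by
    have := l₂.slot_le_of_mem_bestChain hx
    omega
  have hl₁ : ∀ b ∈ NSB.blockHistory N₂, P.honest b.bid = true → NSB.SuperSlot P b.slot →
      1 ≤ b.slot → b.slot + 1 < sl₁ → ∃ c, NSB.ValidChain P.toChainParams (b :: c) ∧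
        (∀ x ∈ c, x ∈ NSB.blockHistory N₂) ∧ c.length < (l₁.bestChain (sl₁ - 1)).length := by
    intro b hb hh hsup hpos hlt
    obtain ⟨b', hb', hh', hbs⟩ := i₁.exists_of_superSlot hsup hpos (by omega)
    -- The block that won this super slot was already sent when `N₁` was reached.
    have e := i₂.eq_of_superSlot hgenesis_slot hb hh (hN₂.blockHistory_subset hb') hh' hsup hpos
      hbs.symm
    subst e
    obtain ⟨c, hc, hcs, hcl⟩ := i₁.length_lt_bestChain hp₁ hp₁_honest hb' hh (by omega)
    rw [hsl₁] at hcl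
    exact ⟨c, hc, fun x hx => hN₂.blockHistory_subset (hcs x hx), hcl⟩
  by_cases hex : ∃ n x r, x :: r <:+ l₂.bestChain (sl₂ - 1) ∧ P.honest x.bid = true ∧
      sl₁ ≤ x.slot + 1 ∧ r.length = n
  · -- `B` is the lowest honest block from a slot `≥ sl₁ - 1` in the second chain. Its baker extended
    -- a chain `c` that satisfies the same assumptions as the second chain, for an earlier slot.
    classical
    obtain ⟨B, c, hBc, hBh, hBs, hcl⟩ := Nat.find_spec hex
    have hB : B ∈ l₂.bestChain (sl₂ - 1) := hBc.subset List.mem_cons_self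
    have hBv := hv₂.suffix hBc
    have hcsub : ∀ x ∈ c, x ∈ NSB.blockHistory N₂ := fun x hx =>
      hsub₂ x (hBc.subset (List.mem_cons_of_mem _ hx))
    have hcc : c <:+ l₂.bestChain (sl₂ - 1) := (List.suffix_cons _ _).trans hBc
    have hcv : NSB.ValidChain P.toChainParams c := by
      cases c with
      | nil =>
        have e : B = P.genesis := by simpa using hBv.ends
        rw [e, hgenesis_slot] at hBs
        omega
      | cons y c => exact hBv.suffix (List.suffix_cons _ _)
    obtain ⟨c', hc', -⟩ := i₂.honest_chain B (hsub₂ B hB) hBh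
    obtain rfl := hBv.eq_of_head_eq hcollision hgenesis_slot hc'.valid hcsub hc'.sub
    have hBlt := hs₂ B hB
    have := i₂.prune_suffix_or_numSuperSlots_le hcollision hgenesis_honest hgenesis_slot hwinner
      hv₁ hcv hsub₁ hcsub (t := sl₁) (u := max sl₁ B.slot) k (le_max_left _ _) (by omega) hs₁
      (fun x hx => by have := hBv.slot_lt hx; omega)
      (fun x hx hh => by
        obtain ⟨q, hq⟩ := NSB.exists_suffix_of_mem hx
        have hlt : q.length < Nat.find hex := by
          have := hq.length_le
          simp only [List.length_cons] at this
          omega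
        by_contra hcon
        exact Nat.find_min hex hlt ⟨x, q, hq.trans hcc, hh, by omega, rfl⟩)
      hl₁ (fun b hb hh _ _ hlt => hc'.growth b hb hh (by omega))
    rcases this with ⟨d, hd⟩ | ⟨sl', hk, hcount⟩
    · obtain ⟨d', hd'⟩ := hcc
      exact .inl ⟨d' ++ d, by rw [List.append_assoc, hd, hd']⟩
    · exact .inr ⟨sl', _, hk, le_max_left _ _, by omega, hcount⟩
  · have := i₂.prune_suffix_or_numSuperSlots_le hcollision hgenesis_honest hgenesis_slot hwinner
      hv₁ hv₂ hsub₁ hsub₂ k hle hsl₂.ge hs₁ hs₂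
      (fun x hx hh => by
        obtain ⟨q, hq⟩ := NSB.exists_suffix_of_mem hx
        by_contra hcon
        exact hex ⟨_, x, q, hq, hh, by omega, rfl⟩)
      hl₁ (fun b hb hh _ _ hlt => by
        have := i₂.length_lt_bestChain hp₂ hp₂_honest hb hh (by omega)
        rwa [hsl₂] at this)
    rcases this with hpre | ⟨sl', hk, hcount⟩
    · exact .inl hpre
    · exact .inr ⟨sl', sl₂, hk, hle, le_rfl, hcount⟩
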